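/- All chain groups and homology groups have $\mathbb{Z}_2$-coefficients. Let $K$ be a finite (abstract) simplicial complex with geometric realization $|K|$, and let $b\ge 0$ be an integer. Then there is a constant $r_K(b)$, depending only on $K$ and $b$, such that for every topological space $\mathbf{R}$ the following holds. 1. If $K$ has no homological almost-embedding into $\mathbf{R}$, then every finite family $\mathcal F$ of subsets of $\mathbf{R}$ with $TC_{\dim K}(\mathcal F)\le b$ satisfies $r(\mathcal F)\le r_K(b)$. 2. If $\dim K\le 1$ and $K$ has no almost-embedding into $\mathbf{R}$, then every finite family $\mathcal F$ of subsets of $\mathbf{R}$ with $TC_{\dim K}(\mathcal F)\le b$ satisfies $r(\mathcal F)\le r_K(b)$. Here: - $TC_k(\mathcal F)=\sup\{\widetilde\beta_i(\bigcap\mathcal G;\mathbb{Z}_2) : \mathcal G\subseteq\mathcal F,\ 0\le i<k\}$, where $\bigcap\emptyset=\mathbf{R}$ and $\widetilde\beta_i$ is the $i$-th reduced (singular) Betti number (all $\widetilde\beta_i$, $i\ge0$, vanish for the empty space; a supremum over the empty set is $0$). - For $S\subseteq\mathbf{R}$, $\operatorname{conv}_{\mathcal F}(S)$ is the intersection of all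 members of $\mathcal F$ containing $S$ (and $\mathbf{R}$ if there are none). The Radon number $r(\mathcal F)$ is the smallest integer $r$ such that every set $S\subseteq\mathbf{R}$ of size $r$ can be split into two disjoint nonempty parts $S=P_1\sqcup P_2$ with $\operatorname{conv}_{\mathcal F}(P_1)\cap\operatorname{conv}_{\mathcal F}(P_2)\ne\emptyset$; $r(\mathcal F)=\infty$ if there is no such $r$. - A homological almost-embedding of $K$ into $\mathbf{R}$ is a chain map $\gamma\colon C_*(K)\to C_*(\mathbf{R})$ from simplicial to singular chains which maps every vertex to a $0$-chain consisting of an odd number of points, and for which $\gamma(\sigma)$ and $\gamma(\tau)$ have disjoint supports whenever $\sigma,\tau$ are disjoint simplices of $K$; the support of a singular chain is the union of the images of the singular simplices with nonzero coefficient. - An almost-embedding of $K$ into $\mathbf{R}$ is a continuous map $f\colon|K|\to\mathbf{R}$ such that the images of disjoint simplices are disjoint. -/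

import Mathlib

open CategoryTheory AlgebraicTopology

universe u v

noncomputable section

/-! ### Convexity relative to a family of sets, and Radon's number -/

/-- `conv_F(S)`: the intersection of all members of `F` that contain `S`
(the whole space if there is no such member). -/
def relConv {X : Type u} (F : Set (Set X)) (S : Set X) : Set X :=
  ⋂₀ {A | A ∈ F ∧ S ⊆ A}

/-- Every set of `r` points can be split into two (nonempty) parts
whose convex hulls relative to `F` intersect. -/
def HasRadonProperty {X : Type u} (F : Set (Set X)) (r : ℕ) : Prop :=
  ∀ S : Finset X, S.card = r →
    ∃ P₁ P₂ : Set X, P₁.Nonempty ∧ P₂.Nonempty ∧ Disjoint P₁ P₂ ∧ P₁ ∪ P₂ = (S : Set X) ∧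
      (relConv F P₁ ∩ relConv F P₂).Nonempty

/-- Radon's number `r(F)`: the smallest `r` with the Radon property, and `∞` if there is none. -/
def radonNumber {X : Type u} (F : Set (Set X)) : ℕ∞ :=
  ⨅ (r : ℕ) (_ : HasRadonProperty F r), (r : ℕ∞)

/-! ### Singular chains and reduced Betti numbers over `ℤ/2` -/

/-- The field `ℤ/2` as an object of the category of `ℤ/2`-modules. -/
abbrev coeffModule : ModuleCat.{u} (ZMod 2) :=
  ModuleCat.of (ZMod 2) (ULift.{u} (ZMod 2))

/-- The singular chain complex `C_*(X; ℤ/2)`. -/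
abbrev singularChains (X : Type u) [TopologicalSpace X] :
    ChainComplex (ModuleCat.{u} (ZMod 2)) ℕ :=
  ((singularChainComplexFunctor (ModuleCat.{u} (ZMod 2))).obj coeffModule).obj (TopCat.of X)

/-- The set of singular `n`-simplices of `X`. -/
abbrev SingularSimplex (X : Type u) [TopologicalSpace X] (n : ℕ) : Type u :=
  (TopCat.toSSet.obj (TopCat.of X)).obj (Opposite.op (SimplexCategory.mk n))

/-- The image in `X` of a singular simplex, regarded as a continuous map on the
standard topological simplex. -/
def SingularSimplex.image {X : Type u} [TopologicalSpace X] {n : ℕ} (x : SingularSimplex X n) :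
    Set X :=
  Set.range (TopCat.toSSetObjEquiv (TopCat.of X) (Opposite.op (SimplexCategory.mk n)) x)

open Classical in
/-- The coefficient of the singular simplex `x` in a singular chain: the linear map that is
`1` on `x` and `0` on all other singular simplices. -/
def singularCoeff {X : Type u} [TopologicalSpace X] {n : ℕ} (x : SingularSimplex X n) :
    (singularChains X).X n →ₗ[ZMod 2] ULift.{u} (ZMod 2) :=
  (((TopCat.toSSet.obj (TopCat.of X)).isColimitChainComplexXCofan coeffModule n).desc
    (Limits.Cofan.mk coeffModule.{u} fun y : SingularSimplex X n =>
      if y = x then 𝟙 coeffModule.{u} else 0)).hom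

/-- The singular simplices with nonzero coefficient in a chain. -/
def chainSimplices {X : Type u} [TopologicalSpace X] {n : ℕ} (c : (singularChains X).X n) :
    Set (SingularSimplex X n) :=
  {x | singularCoeff x c ≠ 0}

/-- The support of a singular chain: the union of the images of the singular simplices
with nonzero coefficient. -/
def chainSupport {X : Type u} [TopologicalSpace X] {n : ℕ} (c : (singularChains X).X n) :
    Set X :=
  ⋃ x ∈ chainSimplices c, x.image

/-- The reduced Betti number of `X` in degree `i` over `ℤ/2`, as an element of `ℕ ∪ {∞}`.
In degree `0` reduced homology is the kernel of the augmentation; in positive degrees it is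
singular homology. (All values are `0` for the empty space.) -/
def reducedBetti (X : Type u) [TopologicalSpace X] : ℕ → ℕ∞
  | 0 => Cardinal.toENat (Module.rank (ZMod 2)
      (LinearMap.ker (TopCat.singularHomology₀ε (TopCat.of X) coeffModule.{u}).hom))
  | i + 1 => Cardinal.toENat (Module.rank (ZMod 2)
      (((singularHomologyFunctor (ModuleCat.{u} (ZMod 2)) (i + 1)).obj coeffModule).obj
        (TopCat.of X)))

/-- The `k`-level topological complexity `TC_k(F)`: the supremum of the reduced Betti numbers
in degrees `0 ≤ i < k` of the intersections of all subfamilies of `F` (the intersection of the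
empty subfamily being the whole space). -/
def topComplexity {X : Type u} [TopologicalSpace X] (k : ℕ∞) (F : Set (Set X)) : ℕ∞ :=
  ⨆ (G : Set (Set X)) (_ : G ⊆ F) (i : ℕ) (_ : (i : ℕ∞) < k), reducedBetti (⋂₀ G : Set X) i

/-! ### Simplicial complexes -/

namespace AbstractSimplicialComplex

variable {V : Type v}

/-- The dimension of a simplicial complex, the largest dimension of a face
(here `0` for the complex without vertices). -/
def dimension (K : AbstractSimplicialComplex V) : ℕ∞ :=
  ⨆ s ∈ K.faces, ((s.card - 1 : ℕ) : ℕ∞)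

/-- The `n`-dimensional simplices of `K`. -/
def Simplex (K : AbstractSimplicialComplex V) (n : ℕ) : Type v :=
  {s : Finset V // s ∈ K.faces ∧ s.card = n + 1}

/-- The simplicial chain group `C_n(K; ℤ/2)`. -/
abbrev Chains (K : AbstractSimplicialComplex V) (n : ℕ) : Type v :=
  K.Simplex n →₀ ZMod 2

open Classical in
/-- The facet of an `(n+1)`-simplex opposite to its vertex `w`. -/
def facet (K : AbstractSimplicialComplex V) {n : ℕ} (s : K.Simplex (n + 1))
    (w : {w // w ∈ s.1}) : K.Simplex n :=
  have hcard : (s.1.erase w.1).card = n + 1 := by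
    rw [Finset.card_erase_of_mem w.2, s.2.2, Nat.add_sub_cancel]
  ⟨s.1.erase w.1,
    (K.isRelLowerSet_faces s.2.1).2 (Finset.erase_subset _ _)
      (Finset.card_pos.mp (by rw [hcard]; exact Nat.succ_pos n)), hcard⟩

/-- The simplicial boundary operator over `ℤ/2`: a simplex is sent to the sum of its facets. -/
def boundary (K : AbstractSimplicialComplex V) (n : ℕ) :
    K.Chains (n + 1) →ₗ[ZMod 2] K.Chains n :=
  Finsupp.linearCombination (ZMod 2) fun s : K.Simplex (n + 1) =>
    ∑ w ∈ s.1.attach, Finsupp.single (K.facet s w) (1 : ZMod 2)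

/-- Chain maps `C_*(K; ℤ/2) → C_*(X; ℤ/2)` from simplicial chains to singular chains. -/
structure SingularChainMap (K : AbstractSimplicialComplex V) (X : Type u)
    [TopologicalSpace X] where
  /-- The component in degree `n`. -/
  app (n : ℕ) : K.Chains n →ₗ[ZMod 2] (singularChains X).X n
  /-- Compatibility with the boundary operators. -/
  comm (n : ℕ) : ((singularChains X).d (n + 1) n).hom ∘ₗ app (n + 1) = app n ∘ₗ K.boundary n

namespace SingularChainMap

variable {K : AbstractSimplicialComplex V} {X : Type u} [TopologicalSpace X]

/-- The image chain of a simplex. -/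
def onSimplex (γ : K.SingularChainMap X) {n : ℕ} (s : K.Simplex n) : (singularChains X).X n :=
  γ.app n (Finsupp.single s 1)

/-- `γ` is nontrivial: the image of every vertex consists of an odd number of points. -/
def IsNontrivial (γ : K.SingularChainMap X) : Prop :=
  ∀ s : K.Simplex 0, Odd (chainSimplices (γ.onSimplex s)).ncard

/-- `γ` is a homological almost-embedding: it is nontrivial, and the image chains of any two
disjoint simplices have disjoint supports. -/
def IsHomologicalAlmostEmbedding (γ : K.SingularChainMap X) : Prop :=
  γ.IsNontrivial ∧
    ∀ (m n : ℕ) (s : K.Simplex m) (t : K.Simplex n), Disjoint s.1 t.1 →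
      Disjoint (chainSupport (γ.onSimplex s)) (chainSupport (γ.onSimplex t))

end SingularChainMap

/-- The geometric realization `|K|` of a complex on a finite vertex set, in barycentric
coordinates: the points of the standard simplex on `V` whose support is a face of `K`. -/
def realization [Fintype V] (K : AbstractSimplicialComplex V) : Set (V → ℝ) :=
  {p | p ∈ stdSimplex ℝ V ∧ ∃ s ∈ K.faces, ∀ w, p w ≠ 0 → w ∈ s}

/-- The closed geometric simplex of `|K|` spanned by a face `s`. -/
def closedSimplex [Fintype V] (K : AbstractSimplicialComplex V) (s : Finset V) :
    Set K.realization :=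
  {p | ∀ w, p.1 w ≠ 0 → w ∈ s}

/-- A continuous map `f : |K| → X` is an almost-embedding if the images of disjoint simplices
are disjoint. -/
def IsAlmostEmbedding [Fintype V] (K : AbstractSimplicialComplex V) {X : Type u}
    [TopologicalSpace X] (f : C(K.realization, X)) : Prop :=
  ∀ s ∈ K.faces, ∀ t ∈ K.faces, Disjoint s t →
    Disjoint (f '' K.closedSimplex s) (f '' K.closedSimplex t)

end AbstractSimplicialComplex

end

/-!
Suppose that a set `S` of `r` points has no Radon partition relative to `F`. Then the hulls
`conv_F(A)` and `conv_F(B)` are disjoint for all disjoint nonempty `A, B ⊆ S`, and each hull, being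
an intersection of members of `F`, has reduced Betti numbers at most `b` in degrees below `dim K`.
If `r` is large, one can build a chain map `C_*(K) → C_*(R)` that sends each simplex `σ` to a chain
in `conv_F(Ψ σ)`, where `Ψ σ ⊆ S` and `Ψ` preserves disjointness and inclusions. Such a map is a
homological almost-embedding (`exists_isHomologicalAlmostEmbedding`).

The chain map is constructed on skeleta of full simplices, one dimension at a time
(`exists_extension`); raising the dimension by one costs a passage to a much smaller vertex set.
Let `g` be defined on simplices of dimension less than `d`, with `d ≥ 1`. The new map is `g`
composed with barycentric subdivision. A `d`-simplex has `(d + 1)!` simplices of dimension `d` in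
its subdivision, an even number. Hence, if the `g`-images of the boundaries of all of them are
homologous in a common hull, then over `ℤ/2` the image of the subdivided boundary bounds there,
and the map extends. There are at most `2 ^ b` homology classes to choose from. So Ramsey's theorem
provides sets of vertices all of whose `d`-simplices have homologous boundaries. As the hull
depends on the simplex under consideration, a second use of Ramsey's theorem is needed: it makes
the pattern of homology classes inside an `M`-element set of vertices `A`, with respect to the hull
of `A`, depend on the order of `A` only. After that the vertices of the subdivision can be placed
once and for all, and for each simplex they are completed, with points reserved for this simplex,
to an `M`-element set in which they occupy a homogeneous subset (`exists_slot_orderEmbedding`,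
`exists_subdivision_pattern`).

All of this takes place in the augmented complex, in which a simplex with `i` vertices is mapped to
degree `i`; this treats reduced homology in degree `0` like homology in positive degrees.

Every vertex is mapped to a single point. If `dim K ≤ 1`, then the image of an edge is a chain in
a hull whose boundary consists of the images of its two ends, so these are joined by a path in
this hull (`joinedIn_of_boundary`), and the paths fit together to an almost-embedding.
-/

noncomputable section

/-! ### Ramsey's theorem -/

/-- The finite Ramsey theorem for hypergraphs. The ground set carries a linear order because the
proof singles out least elements. -/
theorem exists_card_homogeneous (κ : Type*) [Finite κ] (m t : ℕ) :
    ∃ N : ℕ, ∀ (α : Type) [LinearOrder α] (S : Finset α), N ≤ S.card → ∀ χ : Finset α → κ,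
      ∃ T ⊆ S, T.card = t ∧ ∃ c, ∀ A ⊆ T, A.card = m → χ A = c := by
  classical
  have := Fintype.ofFinite κ
  induction m generalizing t with
  | zero =>
    refine ⟨t, fun α _ S hS χ => ?_⟩
    obtain ⟨T, hTS, hT⟩ := Finset.exists_subset_card_eq hS
    refine ⟨T, hTS, hT, χ ∅, fun A _ hA => ?_⟩
    rw [Finset.card_eq_zero.mp hA]
  | succ m ih =>
    -- A set on which the colour of an `(m + 1)`-set depends only on its least element.
    have key : ∀ L : ℕ, ∃ N : ℕ, ∀ (α : Type) [LinearOrder α] (S : Finset α), N ≤ S.card →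
        ∀ χ : Finset α → κ, ∃ T ⊆ S, T.card = L ∧ ∃ ψ : α → κ,
          ∀ a ∈ T, ∀ A ⊆ T, A.card = m → (∀ x ∈ A, a < x) → χ (insert a A) = ψ a := by
      intro L
      induction L with
      | zero =>
        exact ⟨0, fun α _ S _ χ => ⟨∅, by simp, rfl, fun _ => χ ∅, by simp⟩⟩
      | succ L ihL =>
        obtain ⟨N₁, hN₁⟩ := ihL
        obtain ⟨N₂, hN₂⟩ := ih N₁
        refine ⟨N₂ + 1, fun α _ S hS χ => ?_⟩
        have hne : S.Nonempty := Finset.card_pos.mp (by omega)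
        set a := S.min' hne with ha
        have haS : a ∈ S := S.min'_mem hne
        obtain ⟨T', hT'S, hT', c, hc⟩ := hN₂ α (S.erase a)
          (by rw [Finset.card_erase_of_mem haS]; omega) (fun A => χ (insert a A))
        obtain ⟨T, hTT', hT, ψ, hψ⟩ := hN₁ α T' hT'.ge χ
        have hlt : ∀ x ∈ T, a < x := fun x hx => by
          have := Finset.mem_erase.mp (hT'S (hTT' hx))
          exact lt_of_le_of_ne (S.min'_le _ this.2) (Ne.symm this.1)
        have haT : a ∉ T := fun h => lt_irrefl _ (hlt a h)
        refine ⟨insert a T, ?_, ?_, Function.update ψ a c, ?_⟩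
        · intro x hx
          rcases Finset.mem_insert.mp hx with rfl | hx
          · exact haS
          · exact Finset.mem_of_mem_erase (hT'S (hTT' hx))
        · rw [Finset.card_insert_of_notMem haT, hT]
        · intro x hx A hA hAm hxA
          have hax : a ≤ x := by
            rcases Finset.mem_insert.mp hx with rfl | hx
            · exact le_rfl
            · exact (hlt x hx).le
          have hAT : A ⊆ T := fun y hy => by
            rcases Finset.mem_insert.mp (hA hy) with rfl | h
            · exact absurd (hxA _ hy) (not_lt.mpr hax)
            · exact h
          rcases Finset.mem_insert.mp hx with rfl | hx
          · rw [Function.update_self]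
            exact hc A (hAT.trans hTT') hAm
          · rw [Function.update_of_ne (hlt x hx).ne']
            exact hψ x hx A hAT hAm hxA
    obtain ⟨N, hN⟩ := key (Fintype.card κ * t)
    refine ⟨N, fun α _ S hS χ => ?_⟩
    obtain ⟨T, hTS, hT, ψ, hψ⟩ := hN α S hS χ
    have : Nonempty κ := ⟨χ ∅⟩
    obtain ⟨c, -, hc⟩ := Finset.exists_le_card_fiber_of_mul_le_card_of_maps_to
      (s := T) (t := Finset.univ) (f := ψ) (n := t) (fun _ _ => Finset.mem_univ _)
      Finset.univ_nonempty (by rw [hT, Finset.card_univ])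
    obtain ⟨U, hU, hUt⟩ := Finset.exists_subset_card_eq hc
    have hU' : ∀ x ∈ U, x ∈ T ∧ ψ x = c := fun x hx => Finset.mem_filter.mp (hU hx)
    refine ⟨U, fun x hx => hTS (hU' x hx).1, hUt, c, fun A hA hAm => ?_⟩
    have hne : A.Nonempty := Finset.card_pos.mp (by omega)
    have hmem := A.min'_mem hne
    rw [← Finset.insert_erase hmem, hψ _ (hU' _ (hA hmem)).1 _
      (fun x hx => (hU' x (hA (Finset.mem_of_mem_erase hx))).1)
      (by rw [Finset.card_erase_of_mem hmem, hAm]; rfl)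
      (fun x hx => Finset.min'_lt_of_mem_erase_min' _ _ hx)]
    exact (hU' _ (hA hmem)).2

/-- Ramsey's theorem for order embeddings: every colouring of the `m`-tuples in a long enough
chain is constant on the tuples in the image of some order embedding of `P`. -/
theorem exists_homogeneous_orderEmbedding (κ : Type*) [Finite κ] [Nonempty κ] (m : ℕ)
    (P : Type*) [LinearOrder P] [Fintype P] :
    ∃ N : ℕ, ∀ χ : (Fin m ↪o Fin N) → κ,
      ∃ (ι : P ↪o Fin N) (c : κ), ∀ u : Fin m ↪o P, χ (u.trans ι) = c := by
  classical
  obtain ⟨N, hN⟩ := exists_card_homogeneous κ m (Fintype.card P)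
  refine ⟨N, fun χ => ?_⟩
  obtain ⟨c₀⟩ := ‹Nonempty κ›
  obtain ⟨T, -, hT, c, hc⟩ := hN (Fin N) Finset.univ (by simp)
    (fun A => if h : A.card = m then χ (A.orderEmbOfFin h) else c₀)
  let ι : P ↪o Fin N :=
    (Fintype.orderIsoFinOfCardEq P rfl).symm.toOrderEmbedding.trans (T.orderEmbOfFin hT)
  have hι : ∀ x, ι x ∈ T := fun x => T.orderEmbOfFin_mem hT _
  refine ⟨ι, c, fun u => ?_⟩
  have hcard : (Finset.univ.map (u.trans ι).toEmbedding).card = m := by simp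
  have h := hc (Finset.univ.map (u.trans ι).toEmbedding) (fun x hx => by
    obtain ⟨i, -, rfl⟩ := Finset.mem_map.mp hx
    exact hι _) hcard
  rw [dif_pos hcard] at h
  rw [← h]
  congr 1
  exact Finset.orderEmbOfFin_unique' hcard (fun i => by
    exact Finset.mem_map_of_mem (u.trans ι).toEmbedding (Finset.mem_univ i))

/-! ### Barycentric subdivision of simplicial chains -/

theorem linearCombination_mem {ι W : Type*} [AddCommGroup W] [Module (ZMod 2) W]
    (S : Submodule (ZMod 2) W) (z : ι → W) (x : ι →₀ ZMod 2) (h : ∀ i, x i ≠ 0 → z i ∈ S) :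
    Finsupp.linearCombination (ZMod 2) z x ∈ S := by
  rw [Finsupp.linearCombination_apply]
  exact Submodule.finsuppSum_mem _ _ _ _ fun i hi => Submodule.smul_mem _ _ (h i hi)

theorem linearCombination_congr {ι W : Type*} [AddCommGroup W] [Module (ZMod 2) W]
    {z z' : ι → W} {x : ι →₀ ZMod 2} (h : ∀ i, x i ≠ 0 → z i = z' i) :
    Finsupp.linearCombination (ZMod 2) z x = Finsupp.linearCombination (ZMod 2) z' x := by
  simp only [Finsupp.linearCombination_apply]
  exact Finsupp.sum_congr fun i hi => by rw [h i (Finsupp.mem_support_iff.mp hi)]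

section Subdivision

variable {V : Type*} [DecidableEq V]

/-- In characteristic two the sum over all ways to remove two elements in turn vanishes. -/
theorem sum_sum_erase_erase {M : Type*} [AddCommGroup M] [Module (ZMod 2) M]
    (f : Finset V → M) (s : Finset V) :
    ∑ v ∈ s, ∑ w ∈ s.erase v, f ((s.erase v).erase w) = 0 := by
  rw [Finset.sum_sigma']
  refine Finset.sum_involution (fun p _ => ⟨p.2, p.1⟩) ?_ ?_ ?_ ?_
  · rintro ⟨v, w⟩ _
    rw [Finset.erase_right_comm]
    exact ZModModule.add_self _
  · rintro ⟨v, w⟩ h _ heq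
    simp only [Finset.mem_sigma, Finset.mem_erase] at h
    exact h.2.1 (by simpa using congrArg Sigma.fst heq)
  · rintro ⟨v, w⟩ h
    simp only [Finset.mem_sigma, Finset.mem_erase] at h ⊢
    exact ⟨h.2.2, h.2.1.symm, h.1⟩
  · rintro ⟨v, w⟩ _
    rfl

/-- The augmented simplicial boundary over `ℤ/2` on the full simplex with vertex set `V`. -/
def faceBoundary (V : Type*) [DecidableEq V] :
    (Finset V →₀ ZMod 2) →ₗ[ZMod 2] (Finset V →₀ ZMod 2) :=
  Finsupp.linearCombination (ZMod 2) fun s => ∑ v ∈ s, Finsupp.single (s.erase v) 1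

/-- The cone with apex `a` over a simplicial chain. -/
def coneChain (a : V) : (Finset V →₀ ZMod 2) →ₗ[ZMod 2] (Finset V →₀ ZMod 2) :=
  Finsupp.linearCombination (ZMod 2) fun s => Finsupp.single (insert a s) 1

theorem linearCombination_faceBoundary {Y W : Type*} [DecidableEq Y] [AddCommGroup W]
    [Module (ZMod 2) W] (g : Finset Y → W) (x : Finset Y →₀ ZMod 2) :
    Finsupp.linearCombination (ZMod 2) g (faceBoundary Y x) =
      Finsupp.linearCombination (ZMod 2) (fun s => ∑ v ∈ s, g (s.erase v)) x := by
  induction x using Finsupp.induction_linear with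
  | zero => simp
  | add x y hx hy => simp only [map_add, hx, hy]
  | single s r => simp [faceBoundary, Finset.smul_sum]

theorem faceBoundary_coneChain {a : V} {x : Finset V →₀ ZMod 2}
    (hx : x ∈ Finsupp.supported (ZMod 2) (ZMod 2) {s : Finset V | a ∉ s}) :
    faceBoundary V (coneChain a x) = x + coneChain a (faceBoundary V x) := by
  have key : Set.EqOn (faceBoundary V ∘ₗ coneChain a)
      (LinearMap.id + coneChain a ∘ₗ faceBoundary V :
        (Finset V →₀ ZMod 2) →ₗ[ZMod 2] (Finset V →₀ ZMod 2))
      (Submodule.span (ZMod 2) ((fun s => Finsupp.single s (1 : ZMod 2)) ''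
        {s : Finset V | a ∉ s})) := by
    refine LinearMap.eqOn_span' ?_
    rintro _ ⟨s, hs, rfl⟩
    have hs : a ∉ s := hs
    simp only [LinearMap.comp_apply, LinearMap.add_apply, LinearMap.id_apply, coneChain,
      faceBoundary, Finsupp.linearCombination_single, one_smul, map_sum,
      Finset.sum_insert hs, Finset.erase_insert hs]
    congr 1
    refine Finset.sum_congr rfl fun v hv => ?_
    have hav : a ≠ v := by
      rintro rfl
      exact hs hv
    rw [Finset.erase_insert_of_ne hav]
  rw [Finsupp.supported_eq_span_single] at hx
  exact key hx

/-- The barycentric subdivision of a simplex, as a chain: the vertices of the subdivision are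
the nonempty faces of the simplex, and the subdivision is the cone over the subdivided
boundary, with the barycentre of the simplex as apex. -/
def sdChain (s : Finset V) : Finset (Finset V) →₀ ZMod 2 :=
  if s = ∅ then Finsupp.single ∅ 1
  else coneChain s (∑ v : {v // v ∈ s}, sdChain (s.erase v.1))
termination_by s.card
decreasing_by exact Finset.card_erase_lt_of_mem v.2

theorem sdChain_empty : sdChain (∅ : Finset V) = Finsupp.single ∅ 1 := by
  rw [sdChain, if_pos rfl]

theorem sdChain_of_nonempty {s : Finset V} (hs : s.Nonempty) :
    sdChain s = coneChain s (∑ v ∈ s, sdChain (s.erase v)) := by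
  rw [sdChain, if_neg hs.ne_empty, ← Finset.sum_coe_sort s (fun v => sdChain (s.erase v))]

theorem sdChain_singleton (v : V) : sdChain {v} = Finsupp.single {{v}} 1 := by
  rw [sdChain_of_nonempty (Finset.singleton_nonempty v)]
  simp [sdChain_empty, coneChain]

theorem sdChain_mem_supported (s : Finset V) :
    sdChain s ∈ Finsupp.supported (ZMod 2) (ZMod 2)
      {t : Finset (Finset V) | t.card = s.card ∧ ∀ r ∈ t, r ⊆ s ∧ r.Nonempty} := by
  induction s using Finset.strongInduction with
  | H s ih =>
    rcases s.eq_empty_or_nonempty with rfl | hs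
    · rw [sdChain_empty]
      exact Finsupp.single_mem_supported _ _ (by simp)
    · rw [sdChain_of_nonempty hs, map_sum]
      refine Submodule.sum_mem _ fun v hv => ?_
      rw [coneChain, Finsupp.linearCombination_apply]
      refine Submodule.finsuppSum_mem _ _ _ _ fun t ht => Submodule.smul_mem _ _ ?_
      have h := (Finsupp.mem_supported _ _).mp (ih _ (Finset.erase_ssubset hv))
        (Finsupp.mem_support_iff.mpr ht)
      obtain ⟨hcard, hsub⟩ := h
      have hst : s ∉ t := fun h => Finset.notMem_erase v s ((hsub s h).1 hv)
      refine Finsupp.single_mem_supported _ _ ⟨?_, fun r hr => ?_⟩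
      · rw [Finset.card_insert_of_notMem hst, hcard, Finset.card_erase_add_one hv]
      · rcases Finset.mem_insert.mp hr with rfl | hr
        · exact ⟨subset_rfl, hs⟩
        · exact ⟨(hsub r hr).1.trans (Finset.erase_subset _ _), (hsub r hr).2⟩

theorem card_of_sdChain_ne_zero {s : Finset V} {t : Finset (Finset V)} (h : sdChain s t ≠ 0) :
    t.card = s.card ∧ ∀ r ∈ t, r ⊆ s ∧ r.Nonempty :=
  (Finsupp.mem_supported _ _).mp (sdChain_mem_supported s) (Finsupp.mem_support_iff.mpr h)

/-- Barycentric subdivision is a chain map. -/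
theorem faceBoundary_sdChain (s : Finset V) :
    faceBoundary (Finset V) (sdChain s) = ∑ v ∈ s, sdChain (s.erase v) := by
  induction s using Finset.strongInduction with
  | H s ih =>
    rcases s.eq_empty_or_nonempty with rfl | hs
    · simp [sdChain_empty, faceBoundary]
    · rw [sdChain_of_nonempty hs, faceBoundary_coneChain, map_sum,
        Finset.sum_congr rfl fun v hv => ih _ (Finset.erase_ssubset hv),
        sum_sum_erase_erase, map_zero, add_zero]
      refine Submodule.sum_mem _ fun v hv => ?_
      refine Finsupp.supported_mono ?_ (sdChain_mem_supported (s.erase v))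
      exact fun t ht hst => Finset.notMem_erase v s ((ht.2 s hst).1 hv)

/-- The subdivision of a simplex with `k` vertices has `k!` top-dimensional simplices. -/
theorem sum_sdChain (s : Finset V) :
    Finsupp.linearCombination (ZMod 2) (fun _ : Finset (Finset V) => (1 : ZMod 2)) (sdChain s) =
      (s.card.factorial : ZMod 2) := by
  induction s using Finset.strongInduction with
  | H s ih =>
    rcases s.eq_empty_or_nonempty with rfl | hs
    · simp [sdChain_empty]
    · have hcone : ∀ x : Finset (Finset V) →₀ ZMod 2,
          Finsupp.linearCombination (ZMod 2) (fun _ => (1 : ZMod 2)) (coneChain s x) =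
            Finsupp.linearCombination (ZMod 2) (fun _ => (1 : ZMod 2)) x := fun x => by
        induction x using Finsupp.induction_linear with
        | zero => simp
        | add x y hx hy => simp only [map_add, hx, hy]
        | single t r => simp [coneChain]
      have hcard := Finset.card_pos.mpr hs
      rw [sdChain_of_nonempty hs, hcone, map_sum,
        Finset.sum_congr rfl fun v hv => by
          rw [ih _ (Finset.erase_ssubset hv), Finset.card_erase_of_mem hv],
        Finset.sum_const, nsmul_eq_mul, ← Nat.cast_mul, Nat.mul_factorial_pred hcard.ne']

/-- The number of top-dimensional simplices in the subdivision of a simplex of positive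
dimension is even. -/
theorem sum_sdChain_eq_zero {s : Finset V} (hs : 2 ≤ s.card) :
    Finsupp.linearCombination (ZMod 2) (fun _ : Finset (Finset V) => (1 : ZMod 2)) (sdChain s) =
      0 := by
  rw [sum_sdChain, ZMod.natCast_eq_zero_iff]
  exact Nat.dvd_factorial two_pos hs

end Subdivision

/-! ### Placing the simplices of a subdivision in a chain of points -/

section Placement

/-- Slots for the vertices of a subdivision and for auxiliary points: right after the slot
`(c, ⊥)`, which is meant for the vertex number `c`, there are the slots `(c, (s, k))`, reserved
for the `k`-th point of the simplex number `s`; further slots of this kind precede all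
vertices. -/
abbrev Slot (q M : ℕ) : Type := WithBot (Fin q) ×ₗ WithBot (Fin q ×ₗ Fin M)

/-- An increasing sequence of slots that runs through the vertices in `Q` at the positions
prescribed by `β`, and through slots reserved for `s` at all other positions. -/
theorem exists_slot_orderEmbedding {q M m : ℕ} (β : Fin m ↪o Fin M) (Q : Finset (Fin q))
    (hQ : Q.card = m) (s : Fin q) :
    ∃ w : Fin M ↪o Slot q M,
      (∀ i, w (β i) = toLex ((Q.orderEmbOfFin hQ i : WithBot (Fin q)), ⊥)) ∧
      ∀ k, k ∉ Set.range β → ∃ c, w k = toLex (c, ((toLex (s, k) : Fin q ×ₗ Fin M) :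
        WithBot (Fin q ×ₗ Fin M))) := by
  classical
  set h := Q.orderEmbOfFin hQ
  -- The last vertex that has been passed at position `k`.
  let a : Fin M → WithBot (Fin q) := fun k =>
    (Finset.univ.filter fun i => β i ≤ k).sup fun i => (h i : WithBot (Fin q))
  let c : Fin M → WithBot (Fin q ×ₗ Fin M) := fun k =>
    if k ∈ Set.range β then ⊥ else ((toLex (s, k) : Fin q ×ₗ Fin M) : WithBot _)
  have ha : ∀ i, a (β i) = h i := fun i => by
    refine le_antisymm (Finset.sup_le fun j hj => ?_) ?_
    · have : j ≤ i := by simpa using hj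
      exact WithBot.coe_le_coe.mpr (h.monotone this)
    · exact Finset.le_sup (f := fun i => (h i : WithBot (Fin q))) (by simp)
  have hmono : StrictMono fun k => (toLex (a k, c k) : Slot q M) := by
    intro k l hkl
    rw [Prod.Lex.toLex_lt_toLex]
    have hle : a k ≤ a l := Finset.sup_mono fun i hi => by
      simp only [Finset.mem_filter, Finset.mem_univ, true_and] at hi ⊢
      exact hi.trans hkl.le
    by_cases hl : l ∈ Set.range β
    · left
      obtain ⟨i, rfl⟩ := hl
      rw [ha]
      have hbot : (⊥ : WithBot (Fin q)) < h i := WithBot.bot_lt_coe _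
      change (Finset.univ.filter fun j => β j ≤ k).sup (fun j => (h j : WithBot (Fin q))) < h i
      refine (Finset.sup_lt_iff hbot).mpr fun j hj => ?_
      have : β j < β i := lt_of_le_of_lt (by simpa using hj) hkl
      exact WithBot.coe_lt_coe.mpr (h.strictMono (β.lt_iff_lt.mp this))
    · rcases hle.lt_or_eq with hlt | heq
      · exact Or.inl hlt
      · refine Or.inr ⟨heq, ?_⟩
        by_cases hk : k ∈ Set.range β
        · simp only [c, if_pos hk, if_neg hl]
          exact WithBot.bot_lt_coe _
        · simp only [c, if_neg hk, if_neg hl]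
          refine WithBot.coe_lt_coe.mpr ?_
          rw [Prod.Lex.toLex_lt_toLex]
          exact Or.inr ⟨rfl, hkl⟩
  refine ⟨OrderEmbedding.ofStrictMono _ hmono, fun i => ?_, fun k hk => ⟨a k, ?_⟩⟩
  · simp [OrderEmbedding.coe_ofStrictMono, ha, c]
  · simp only [OrderEmbedding.coe_ofStrictMono, c, if_neg hk]

/-- The face a slot belongs to, where `e` numbers the faces. -/
def Slot.owner {q M : ℕ} {X : Type*} (e : Finset X ≃ Fin q) (p : Slot q M) : Finset X :=
  match (ofLex p).2, (ofLex p).1 with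
  | (x : Fin q ×ₗ Fin M), _ => e.symm (ofLex x).1
  | ⊥, (c : Fin q) => e.symm c
  | ⊥, ⊥ => ∅

/-- The elements of `I` whose nonempty owner is contained in `A`. -/
def ownedBy {I X : Type*} [Fintype I] [DecidableEq X] (owner : I → Finset X) (A : Finset X) :
    Finset I :=
  Finset.univ.filter fun x => (owner x).Nonempty ∧ owner x ⊆ A

/-- The placement of a subdivision. In the application `χ A t` is the homology class, in the hull
of `A`, of the image of the boundary of the simplex `t`. Each point is owned by at most one face;
the barycentre of a face is owned by it. For every `n`-element simplex `s` there is a set `A` of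
points owned by faces of `s` in which all simplices of the subdivision of `s` have the same
colour. -/
theorem exists_subdivision_pattern (b n N' : ℕ) (hn : 0 < n) :
    ∃ N : ℕ, ∀ χ : Finset (Fin N) → Finset (Fin N) → (Fin b → ZMod 2),
      ∃ (owner : Fin N → Finset (Fin N')) (bary : Finset (Fin N') → Fin N),
        Function.Injective bary ∧ (∀ r, owner (bary r) = r) ∧
        ∀ s : Finset (Fin N'), s.card = n →
          ∃ A ⊆ ownedBy owner s, ∃ c, ∀ t : Finset (Finset (Fin N')), t.card = n →
            (∀ r ∈ t, r ⊆ s ∧ r.Nonempty) → t.image bary ⊆ A ∧ χ A (t.image bary) = c := by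
  classical
  obtain ⟨q, ⟨e⟩⟩ : ∃ q, Nonempty (Finset (Fin N') ≃ Fin q) :=
    ⟨_, ⟨Fintype.equivFin _⟩⟩
  obtain ⟨M, hM⟩ := exists_homogeneous_orderEmbedding (Fin b → ZMod 2) n (Fin (2 ^ n - 1))
  obtain ⟨N, hN⟩ := exists_homogeneous_orderEmbedding (Finset (Fin M) → (Fin b → ZMod 2)) M
    (Slot q M)
  refine ⟨N, fun χ => ?_⟩
  -- Inside the image of `ι` the colours of the simplices in an `M`-element set, with respect to
  -- this set, depend on their positions only.
  obtain ⟨ι, f, hf⟩ := hN fun w Q =>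
    χ (Finset.univ.map w.toEmbedding) (Q.map w.toEmbedding)
  -- The positions in the image of `β` are those where every simplex has the colour `c`.
  obtain ⟨β, c, hc⟩ := hM fun w => f (Finset.univ.map w.toEmbedding)
  have hinj : Function.Injective ι := ι.injective
  let bary : Finset (Fin N') → Fin N := fun r =>
    ι (toLex ((e r : WithBot (Fin q)), (⊥ : WithBot (Fin q ×ₗ Fin M))))
  have hbary : Function.Injective bary := fun r r' h => by
    have := congrArg (fun p => (ofLex p).1) (hinj h)
    exact e.injective (WithBot.coe_injective this)
  refine ⟨Function.extend ι (Slot.owner e) fun _ => ∅, bary, hbary, fun r => ?_,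
    fun s hs => ?_⟩
  · rw [hinj.extend_apply]
    exact e.symm_apply_apply r
  have hs0 : s.Nonempty := Finset.card_pos.mp (hs ▸ hn)
  obtain ⟨Q, hQdef⟩ : ∃ Q, Q = (s.powerset.erase ∅).map e.toEmbedding := ⟨_, rfl⟩
  have hQ : Q.card = 2 ^ n - 1 := by
    rw [hQdef, Finset.card_map, Finset.card_erase_of_mem (Finset.empty_mem_powerset s),
      Finset.card_powerset, hs]
  obtain ⟨w, hw, hw'⟩ := exists_slot_orderEmbedding β _ hQ (e s)
  refine ⟨Finset.univ.map (w.trans ι).toEmbedding, ?_, c, fun t ht hts => ?_⟩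
  · intro x hx
    obtain ⟨k, -, rfl⟩ := Finset.mem_map.mp hx
    simp only [ownedBy, Finset.mem_filter, Finset.mem_univ, true_and]
    change (Function.extend ι (Slot.owner e) (fun _ => ∅) (ι (w k))).Nonempty ∧
      Function.extend ι (Slot.owner e) (fun _ => ∅) (ι (w k)) ⊆ s
    rw [hinj.extend_apply]
    by_cases hk : k ∈ Set.range β
    · obtain ⟨i, rfl⟩ := hk
      obtain ⟨r, hr, hri⟩ : ∃ r ∈ s.powerset.erase ∅, e r = Q.orderEmbOfFin hQ i := by
        have hi := Q.orderEmbOfFin_mem hQ i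
        simpa only [hQdef, Finset.mem_map, Equiv.coe_toEmbedding] using hi
      have howner : Slot.owner e (w (β i)) = r := by
        rw [hw i, ← hri]
        exact e.symm_apply_apply r
      rw [howner]
      simp only [Finset.mem_erase, Finset.mem_powerset] at hr
      exact ⟨Finset.nonempty_iff_ne_empty.mpr hr.1, hr.2⟩
    · obtain ⟨a, ha⟩ := hw' k hk
      have howner : Slot.owner e (w k) = s := by
        rw [ha]
        exact e.symm_apply_apply s
      rw [howner]
      exact ⟨hs0, subset_rfl⟩
  · let K : Finset (Fin (2 ^ n - 1)) :=
      Finset.univ.filter fun i => e.symm (Q.orderEmbOfFin hQ i) ∈ t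
    have himage : t.image bary = (K.map β.toEmbedding).map (w.trans ι).toEmbedding := by
      ext x
      constructor
      · intro hx
        obtain ⟨r, hr, rfl⟩ := Finset.mem_image.mp hx
        have hrQ : e r ∈ Q := hQdef ▸ Finset.mem_map_of_mem e.toEmbedding (by
          rw [Finset.mem_erase, Finset.mem_powerset]
          exact ⟨(hts r hr).2.ne_empty, (hts r hr).1⟩)
        rw [← Finset.mem_coe, ← Finset.range_orderEmbOfFin Q hQ] at hrQ
        obtain ⟨i, hi⟩ := hrQ
        refine Finset.mem_map.mpr ⟨β i, Finset.mem_map_of_mem _ ?_, ?_⟩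
        · simp only [K, Finset.mem_filter, Finset.mem_univ, true_and, hi,
            Equiv.symm_apply_apply]
          exact hr
        · change ι (w (β i)) = bary r
          rw [hw i, hi]
      · intro hx
        obtain ⟨k, hk, rfl⟩ := Finset.mem_map.mp hx
        obtain ⟨i, hi, rfl⟩ := Finset.mem_map.mp hk
        refine Finset.mem_image.mpr ⟨_, (Finset.mem_filter.mp hi).2, ?_⟩
        change _ = ι (w (β i))
        rw [hw i]
        simp only [bary, Equiv.apply_symm_apply]
    have hK : K.card = n := by
      have := Finset.card_image_of_injective t hbary
      rwa [himage, Finset.card_map, Finset.card_map, ht] at this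
    refine ⟨?_, ?_⟩
    · rw [himage]
      exact Finset.map_subset_map.mpr (Finset.subset_univ _)
    · rw [himage]
      have h1 := congrFun (hf w) (K.map β.toEmbedding)
      have h2 := hc (K.orderEmbOfFin hK)
      have h3 : Finset.univ.map ((K.orderEmbOfFin hK).trans β).toEmbedding =
          K.map β.toEmbedding := by
        ext x
        simp only [Finset.mem_map, Finset.mem_univ, true_and]
        constructor
        · rintro ⟨i, rfl⟩
          exact ⟨_, K.orderEmbOfFin_mem hK i, rfl⟩
        · rintro ⟨y, hy, rfl⟩
          rw [← Finset.mem_coe, ← Finset.range_orderEmbOfFin K hK] at hy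
          obtain ⟨i, rfl⟩ := hy
          exact ⟨i, rfl⟩
      rw [h3] at h2
      exact h1.trans h2

end Placement

/-! ### Extending carried chain maps to the next skeleton -/

section Step

variable (M : ChainComplex (ModuleCat.{u} (ZMod 2)) ℕ)

/-- `g` is an augmented chain map to `M`, defined on the simplices with at most `n` vertices
of the full simplex on `X` (the empty simplex included), which maps every simplex into its
carrier. A simplex with `i` vertices is mapped to degree `i`. -/
structure IsCarriedChainMap {X : Type*} [DecidableEq X]
    (D : Finset X → ∀ i, Submodule (ZMod 2) (M.X i)) (n : ℕ) (g : ∀ i, Finset X → M.X i) :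
    Prop where
  d_eq (i : ℕ) (s : Finset X) : s.card = i + 1 → i + 1 ≤ n →
    (M.d (i + 1) i).hom (g (i + 1) s) = ∑ v ∈ s, g i (s.erase v)
  mem (i : ℕ) (s : Finset X) : s.card = i → i ≤ n → g i s ∈ D s i

/-- There is a colouring of the chains of degree `j + 1` with `2 ^ b` colours such that any two
cycles in `S` of the same colour differ by a boundary in `S`. For a subcomplex `S` this expresses
that its homology in degree `j + 1` has dimension at most `b`. -/
def HasCycleColoring (b j : ℕ) (S : ∀ i, Submodule (ZMod 2) (M.X i)) : Prop :=
  ∃ φ : M.X (j + 1) → (Fin b → ZMod 2), ∀ z ∈ S (j + 1), ∀ z' ∈ S (j + 1),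
    (M.d (j + 1) j).hom z = 0 → (M.d (j + 1) j).hom z' = 0 → φ z = φ z' →
      ∃ e ∈ S (j + 2), (M.d (j + 2) (j + 1)).hom e = z - z'

variable {M}

/-- A sum of an even number of homologous cycles is a boundary. -/
theorem exists_boundary_of_homologous {Y : Type*} {j : ℕ}
    {S : ∀ i, Submodule (ZMod 2) (M.X i)} (x : Y →₀ ZMod 2) (z : Y → M.X (j + 1))
    (hx : Finsupp.linearCombination (ZMod 2) (fun _ => (1 : ZMod 2)) x = 0)
    (hz : ∀ s t, x s ≠ 0 → x t ≠ 0 →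
      ∃ e ∈ S (j + 2), (M.d (j + 2) (j + 1)).hom e = z s - z t) :
    ∃ e ∈ S (j + 2), (M.d (j + 2) (j + 1)).hom e = Finsupp.linearCombination (ZMod 2) z x := by
  rcases eq_or_ne x 0 with rfl | hne
  · exact ⟨0, Submodule.zero_mem _, by simp⟩
  obtain ⟨t, ht⟩ := Finsupp.ne_iff.mp hne
  have hz' : ∀ s : Y, ∃ e : M.X (j + 2), x s ≠ 0 →
      e ∈ S (j + 2) ∧ (M.d (j + 2) (j + 1)).hom e = z s - z t := fun s => by
    by_cases hs : x s = 0
    · exact ⟨0, fun h => absurd hs h⟩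
    · obtain ⟨e, he⟩ := hz s t hs ht
      exact ⟨e, fun _ => he⟩
  choose e he using hz'
  refine ⟨Finsupp.linearCombination (ZMod 2) e x, ?_, ?_⟩
  · rw [Finsupp.linearCombination_apply]
    exact Submodule.finsuppSum_mem _ _ _ _ fun s hs => Submodule.smul_mem _ _ (he s hs).1
  · have hsum : (x.sum fun _ r => r) = 0 := by
      simpa [Finsupp.linearCombination_apply] using hx
    calc (M.d (j + 2) (j + 1)).hom (Finsupp.linearCombination (ZMod 2) e x)
        = x.sum fun s r => r • (z s - z t) := by
          rw [Finsupp.linearCombination_apply, map_finsuppSum]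
          refine Finsupp.sum_congr fun s hs => ?_
          rw [map_smul, (he s (Finsupp.mem_support_iff.mp hs)).2]
      _ = Finsupp.linearCombination (ZMod 2) z x - (x.sum fun _ r => r) • z t := by
          simp only [smul_sub, Finsupp.linearCombination_apply, Finsupp.sum,
            Finset.sum_sub_distrib, Finset.sum_smul]
      _ = _ := by rw [hsum, zero_smul, sub_zero]

/-- The boundary of a would-be image of the simplex `s` is a cycle. -/
theorem IsCarriedChainMap.d_sum_erase {X : Type*} [DecidableEq X]
    {D : Finset X → ∀ i, Submodule (ZMod 2) (M.X i)} {n : ℕ} {g : ∀ i, Finset X → M.X i}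
    (hg : IsCarriedChainMap M D n g) {j : ℕ} (hj : j + 1 ≤ n) {s : Finset X}
    (hs : s.card = j + 2) :
    (M.d (j + 1) j).hom (∑ v ∈ s, g (j + 1) (s.erase v)) = 0 := by
  rw [map_sum, Finset.sum_congr rfl fun v hv => hg.d_eq j (s.erase v)
    (by rw [Finset.card_erase_of_mem hv, hs]; rfl) hj]
  exact sum_sum_erase_erase (g j) s

/-- A chain map on the simplices with at most `j + 1` vertices yields one on the simplices with at
most `j + 2` vertices of a smaller simplex. The latter agrees with the former, composed with
subdivision, on the simplices with at most `j + 1` vertices. The new carriers are old carriers of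
sets of owned points, so the hypotheses on carriers persist. -/
theorem exists_extension (b j N' : ℕ) :
    ∃ N : ℕ, ∀ (M : ChainComplex (ModuleCat.{u} (ZMod 2)) ℕ)
      (D : Finset (Fin N) → ∀ i, Submodule (ZMod 2) (M.X i)) (g : ∀ i, Finset (Fin N) → M.X i),
      (∀ A B, A ⊆ B → ∀ i, D A i ≤ D B i) → (∀ A, HasCycleColoring M b j (D A)) →
      IsCarriedChainMap M D (j + 1) g →
      ∃ (owner : Fin N → Finset (Fin N')) (g' : ∀ i, Finset (Fin N') → M.X i)
        (p : Fin N' → Fin N),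
        IsCarriedChainMap M (fun A => D (ownedBy owner A)) (j + 2) g' ∧
        ∀ v, owner (p v) = {v} ∧ g' 1 {v} = g 1 {p v} := by
  classical
  obtain ⟨N, hN⟩ := exists_subdivision_pattern b (j + 2) N' (by omega)
  refine ⟨N, fun M D g hD hcol hg => ?_⟩
  choose φ hφ using hcol
  -- The cycle that has to be filled in order to extend `g` over the simplex `t`.
  let z : Finset (Fin N) → M.X (j + 1) := fun t => ∑ v ∈ t, g (j + 1) (t.erase v)
  obtain ⟨owner, bary, hbary, howner, hpat⟩ := hN fun A t => φ A (z t)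
  -- The composition of `g` with the subdivision operator.
  let h : ∀ i, Finset (Fin N') → M.X i := fun i s =>
    Finsupp.linearCombination (ZMod 2) (fun t => g i (t.image bary)) (sdChain s)
  have hsum : ∀ i s, ∑ v ∈ s, h i (s.erase v) = Finsupp.linearCombination (ZMod 2)
      (fun t => ∑ x ∈ t.image bary, g i ((t.image bary).erase x)) (sdChain s) := fun i s => by
    rw [← map_sum, ← faceBoundary_sdChain, linearCombination_faceBoundary]
    refine linearCombination_congr fun t _ => ?_
    rw [Finset.sum_image hbary.injOn]
    exact Finset.sum_congr rfl fun r _ => by rw [Finset.image_erase hbary]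
  have hbarymem : ∀ {s : Finset (Fin N')} {t : Finset (Finset (Fin N'))}, sdChain s t ≠ 0 →
      t.image bary ⊆ ownedBy owner s ∧ (t.image bary).card = s.card := fun {s t} ht => by
    obtain ⟨hcard, hsub⟩ := card_of_sdChain_ne_zero ht
    refine ⟨fun x hx => ?_, by rw [Finset.card_image_of_injective _ hbary, hcard]⟩
    obtain ⟨r, hr, rfl⟩ := Finset.mem_image.mp hx
    simp only [ownedBy, Finset.mem_filter, Finset.mem_univ, true_and, howner]
    exact ⟨(hsub r hr).2, (hsub r hr).1⟩
  have hfill : ∀ s : Finset (Fin N'), ∃ e : M.X (j + 2), s.card = j + 2 →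
      e ∈ D (ownedBy owner s) (j + 2) ∧
        (M.d (j + 2) (j + 1)).hom e = ∑ v ∈ s, h (j + 1) (s.erase v) := fun s => by
    by_cases hs : s.card = j + 2
    swap
    · exact ⟨0, fun h => absurd h hs⟩
    obtain ⟨A, hA, c, hc⟩ := hpat s hs
    have hcycle : ∀ t, sdChain s t ≠ 0 → z (t.image bary) ∈ D A (j + 1) ∧
        (M.d (j + 1) j).hom (z (t.image bary)) = 0 ∧ φ A (z (t.image bary)) = c := fun t ht => by
      obtain ⟨hcard, hsub⟩ := card_of_sdChain_ne_zero ht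
      obtain ⟨htA, hcol⟩ := hc t (hcard.trans hs) hsub
      have htcard : (t.image bary).card = j + 2 := (hbarymem ht).2.trans hs
      refine ⟨Submodule.sum_mem _ fun v hv => ?_, hg.d_sum_erase le_rfl htcard, hcol⟩
      refine hD _ _ ((Finset.erase_subset _ _).trans htA) _ (hg.mem (j + 1) _ ?_ le_rfl)
      rw [Finset.card_erase_of_mem hv, htcard]
      rfl
    obtain ⟨e, he, hde⟩ := exists_boundary_of_homologous (S := D A) (sdChain s)
      (fun t => z (t.image bary)) (sum_sdChain_eq_zero (by omega)) fun t t' ht ht' => by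
        obtain ⟨h1, h2, h3⟩ := hcycle t ht
        obtain ⟨h1', h2', h3'⟩ := hcycle t' ht'
        exact hφ A _ h1 _ h1' h2 h2' (h3.trans h3'.symm)
    exact ⟨e, fun _ => ⟨hD _ _ hA _ he, hde.trans (hsum (j + 1) s).symm⟩⟩
  choose e he using hfill
  refine ⟨owner, Function.update h (j + 2) e, fun v => bary {v}, ⟨?_, ?_⟩, fun v => ?_⟩
  · intro i s hs hi
    rcases eq_or_ne i (j + 1) with rfl | hne
    · rw [Function.update_self, Function.update_of_ne (by omega)]
      exact (he s hs).2
    · rw [Function.update_of_ne (by omega), Function.update_of_ne (by omega), hsum,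
        Finsupp.apply_linearCombination]
      refine linearCombination_congr fun t ht => ?_
      exact hg.d_eq i _ ((hbarymem ht).2.trans hs) (by omega)
  · intro i s hs hi
    rcases eq_or_ne i (j + 2) with rfl | hne
    · rw [Function.update_self]
      exact (he s hs).1
    · rw [Function.update_of_ne hne]
      exact linearCombination_mem _ _ _ fun t ht => hD _ _ (hbarymem ht).1 _
        (hg.mem i _ ((hbarymem ht).2.trans hs) (by omega))
  · rw [Function.update_of_ne (by omega)]
    exact ⟨howner _, by simp [h, sdChain_singleton]⟩

end Step

section Iteration

/-- A sufficiently long sequence of vertices with carriers of bounded homology admits a carried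
chain map on a full skeleton. Subfamilies of vertices are reindexed by `Ψ`. -/
theorem exists_carried_chainMap (b n N' : ℕ) :
    ∃ N : ℕ, ∀ (M : ChainComplex (ModuleCat.{u} (ZMod 2)) ℕ)
      (D : Finset (Fin N) → ∀ i, Submodule (ZMod 2) (M.X i)) (g : ∀ i, Finset (Fin N) → M.X i),
      (∀ A B, A ⊆ B → ∀ i, D A i ≤ D B i) → (∀ A, ∀ j < n, HasCycleColoring M b j (D A)) →
      IsCarriedChainMap M D 1 g →
      ∃ (Ψ : Finset (Fin N') → Finset (Fin N)) (g' : ∀ i, Finset (Fin N') → M.X i)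
        (p : Fin N' → Fin N),
        IsCarriedChainMap M (fun A => D (Ψ A)) (n + 1) g' ∧ Monotone Ψ ∧
        (∀ A B, Disjoint A B → Disjoint (Ψ A) (Ψ B)) ∧
        ∀ v, p v ∈ Ψ {v} ∧ g' 1 {v} = g 1 {p v} := by
  classical
  induction n generalizing N' with
  | zero =>
    exact ⟨N', fun M D g _ _ hg => ⟨id, g, id, hg, monotone_id, fun _ _ h => h,
      fun v => ⟨Finset.mem_singleton_self v, rfl⟩⟩⟩
  | succ n ih =>
    obtain ⟨N₁, hN₁⟩ := exists_extension.{u} b n N'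
    obtain ⟨N, hN⟩ := ih N₁
    refine ⟨N, fun M D g hD hcol hg => ?_⟩
    obtain ⟨Ψ, g₁, p₁, hg₁, hΨ, hΨd, hp₁⟩ :=
      hN M D g hD (fun A j hj => hcol A j (hj.trans n.lt_succ_self)) hg
    obtain ⟨owner, g₂, p₂, hg₂, hp₂⟩ := hN₁ M (fun A => D (Ψ A)) g₁
      (fun A B h => hD _ _ (hΨ h)) (fun A => hcol _ n n.lt_succ_self) hg₁
    refine ⟨fun A => Ψ (ownedBy owner A), g₂, fun v => p₁ (p₂ v), hg₂, fun A B h => hΨ ?_,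
      fun A B h => hΨd _ _ ?_, fun v => ⟨?_, ?_⟩⟩
    · intro x hx
      simp only [ownedBy, Finset.mem_filter, Finset.mem_univ, true_and] at hx ⊢
      exact ⟨hx.1, hx.2.trans h⟩
    · rw [Finset.disjoint_left]
      intro x hx hx'
      simp only [ownedBy, Finset.mem_filter, Finset.mem_univ, true_and] at hx hx'
      obtain ⟨y, hy⟩ := hx.1
      exact Finset.disjoint_left.mp h (hx.2 hy) (hx'.2 hy)
    · refine hΨ ?_ (hp₁ (p₂ v)).1
      simp [ownedBy, (hp₂ v).1]
    · rw [(hp₂ v).2, (hp₁ _).2]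

end Iteration

/-! ### Singular chains, augmentation and subspaces -/

section Singular

/-- A cycle whose homology class vanishes is a boundary. -/
theorem exists_boundary_of_homologyπ_eq_zero (S : ShortComplex (ModuleCat.{u} (ZMod 2)))
    (c : S.cycles) (hc : S.homologyπ.hom c = 0) : ∃ e, S.f.hom e = S.iCycles.hom c := by
  have h1 := ConcreteCategory.congr_hom S.π_moduleCatCyclesIso_hom c
  have h2 : (LinearMap.range S.moduleCatToCycles).mkQ (S.moduleCatCyclesIso.hom.hom c) = 0 := by
    refine Eq.trans h1.symm ?_
    change S.moduleCatHomologyIso.hom.hom (S.homologyπ.hom c) = 0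
    rw [hc, map_zero]
  obtain ⟨e, he⟩ := (Submodule.Quotient.mk_eq_zero _).mp h2
  exact ⟨e, (congrArg Subtype.val he).trans
    (ConcreteCategory.congr_hom S.moduleCatCyclesIso_hom_i c)⟩

/-- The homology class of a cycle, as a function on all chains (with junk values on chains that
are not cycles). Cycles of the same class differ by a boundary. -/
theorem exists_homologyClass (C : ChainComplex (ModuleCat.{u} (ZMod 2)) ℕ) (i : ℕ) :
    ∃ π : C.X i → C.homology i,
      (∀ z z', (C.d i ((ComplexShape.down ℕ).next i)).hom z = 0 →
        (C.d i ((ComplexShape.down ℕ).next i)).hom z' = 0 → π z = π z' →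
          ∃ e, (C.d (i + 1) i).hom e = z - z') ∧
      ∀ c : C.cycles i, π ((C.iCycles i).hom c) = (C.homologyπ i).hom c := by
  have hinj : Function.Injective (C.iCycles i).hom :=
    (ModuleCat.mono_iff_injective _).mp inferInstance
  have hcyc : ∀ z, (C.d i ((ComplexShape.down ℕ).next i)).hom z = 0 →
      ∃ c : C.cycles i, (C.iCycles i).hom c = z := fun z hz =>
    ⟨(C.sc i).moduleCatCyclesIso.inv.hom ⟨z, hz⟩, by
      exact ConcreteCategory.congr_hom (C.sc i).moduleCatCyclesIso_inv_iCycles ⟨z, hz⟩⟩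
  have hπ : ∀ c : C.cycles i, (C.homologyπ i).hom
      (Function.invFun (C.iCycles i).hom ((C.iCycles i).hom c)) = (C.homologyπ i).hom c :=
    fun c => congrArg _ (Function.leftInverse_invFun hinj c)
  refine ⟨fun z => (C.homologyπ i).hom (Function.invFun (C.iCycles i).hom z),
    fun z z' hz hz' h => ?_, hπ⟩
  obtain ⟨c, rfl⟩ := hcyc z hz
  obtain ⟨c', rfl⟩ := hcyc z' hz'
  have h : (C.homologyπ i).hom c = (C.homologyπ i).hom c' := (hπ c).symm.trans (h.trans (hπ c'))
  obtain ⟨e, he⟩ := exists_boundary_of_homologyπ_eq_zero (C.sc i) (c - c')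
    ((map_sub (C.homologyπ i).hom c c').trans (sub_eq_zero.mpr h))
  have hd : ∀ k, k = i + 1 → ∀ e : C.X k, (C.d k i).hom e = (C.iCycles i).hom (c - c') →
      ∃ e, (C.d (i + 1) i).hom e = (C.iCycles i).hom (c - c') := by
    rintro _ rfl e he
    exact ⟨e, he⟩
  rw [← map_sub]
  exact hd _ (ChainComplex.prev _ _) e he

/-- A module of rank at most `b` over `ℤ/2` has at most `2 ^ b` elements. -/
theorem exists_injective_of_rank_le {W : Type*} [AddCommGroup W] [Module (ZMod 2) W] {b : ℕ}
    (h : Cardinal.toENat (Module.rank (ZMod 2) W) ≤ b) :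
    ∃ f : W → (Fin b → ZMod 2), Function.Injective f := by
  have h' : Module.rank (ZMod 2) W ≤ b := by
    simpa using h
  have hfin : Module.Finite (ZMod 2) W :=
    Module.rank_lt_aleph0_iff.mp (h'.trans_lt (Cardinal.natCast_lt_aleph0))
  have := Module.finite_of_finite (ZMod 2) (M := W)
  have := Fintype.ofFinite W
  obtain ⟨f⟩ := Function.Embedding.nonempty_of_card_le (α := W) (β := Fin b → ZMod 2) (by
    rw [Module.card_eq_pow_finrank (K := ZMod 2) (V := W)]
    simpa using Nat.pow_le_pow_right two_pos (Module.finrank_le_of_rank_le h'))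
  exact ⟨f, f.injective⟩

variable {X : Type u} [TopologicalSpace X] {n : ℕ}

/-- The chain consisting of one singular simplex. -/
def singularGenerator (x : SingularSimplex X n) : coeffModule.{u} ⟶ (singularChains X).X n :=
  (TopCat.toSSet.obj (TopCat.of X)).ιChainComplex x

theorem singularChains_hom_ext {T : ModuleCat.{u} (ZMod 2)} {f g : (singularChains X).X n ⟶ T}
    (h : ∀ x : SingularSimplex X n, singularGenerator x ≫ f = singularGenerator x ≫ g) : f = g :=
  SSet.chainComplex_hom_ext h

variable (X) in
/-- The augmentation of the singular chain complex. -/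
def augmentation : (singularChains X).X 0 ⟶ coeffModule.{u} :=
  ((TopCat.toSSet.obj (TopCat.of X)).isColimitChainComplexXCofan coeffModule 0).desc
    (Limits.Cofan.mk coeffModule.{u} fun _ : SingularSimplex X 0 => 𝟙 coeffModule.{u})

theorem singularGenerator_augmentation (x : SingularSimplex X 0) :
    singularGenerator x ≫ augmentation X = 𝟙 _ :=
  ((TopCat.toSSet.obj (TopCat.of X)).isColimitChainComplexXCofan coeffModule.{u} 0).fac _ ⟨x⟩

open Classical in
/-- The coefficient of the singular simplex `x`, as a morphism. -/
def coeffHom (x : SingularSimplex X n) : (singularChains X).X n ⟶ coeffModule.{u} :=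
  ((TopCat.toSSet.obj (TopCat.of X)).isColimitChainComplexXCofan coeffModule n).desc
    (Limits.Cofan.mk coeffModule.{u} fun y : SingularSimplex X n =>
      if y = x then 𝟙 coeffModule.{u} else 0)

open Classical in
theorem singularGenerator_coeff (x y : SingularSimplex X n) :
    singularGenerator y ≫ coeffHom x = if y = x then 𝟙 coeffModule.{u} else 0 :=
  ((TopCat.toSSet.obj (TopCat.of X)).isColimitChainComplexXCofan coeffModule.{u} n).fac _ ⟨y⟩

theorem singularGenerator_d (x : SingularSimplex X (n + 1)) :
    singularGenerator x ≫ (singularChains X).d (n + 1) n =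
      ∑ i : Fin (n + 2), (-1) ^ i.val •
        singularGenerator ((TopCat.toSSet.obj (TopCat.of X)).δ i x) :=
  SSet.ιChainComplex_d _ _ _

theorem d_augmentation : (singularChains X).d 1 0 ≫ augmentation X = 0 := by
  refine singularChains_hom_ext fun x => ?_
  rw [← Category.assoc, singularGenerator_d]
  simp [Fin.sum_univ_two, Preadditive.add_comp,
    singularGenerator_augmentation]

/-- The chain map induced by a continuous map. -/
def singularMap {Y : Type u} [TopologicalSpace Y] (f : C(X, Y)) :
    singularChains X ⟶ singularChains Y :=
  ((singularChainComplexFunctor (ModuleCat.{u} (ZMod 2))).obj coeffModule).map (TopCat.ofHom f)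

theorem singularGenerator_map {Y : Type u} [TopologicalSpace Y] (f : C(X, Y))
    (x : SingularSimplex X n) :
    singularGenerator x ≫ (singularMap f).f n =
      singularGenerator ((TopCat.toSSet.map (TopCat.ofHom f)).app _ x) :=
  SSet.ι_chainComplexMap_f _ _ _ _ _

theorem singularMap_augmentation {Y : Type u} [TopologicalSpace Y] (f : C(X, Y)) :
    (singularMap f).f 0 ≫ augmentation Y = augmentation X := by
  refine singularChains_hom_ext fun x => ?_
  rw [← Category.assoc, singularGenerator_map, singularGenerator_augmentation,
    singularGenerator_augmentation]

theorem singularMap_comp {Y Z : Type u} [TopologicalSpace Y] [TopologicalSpace Z]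
    (f : C(X, Y)) (g : C(Y, Z)) : singularMap (g.comp f) = singularMap f ≫ singularMap g := by
  simp only [singularMap, TopCat.ofHom_comp, Functor.map_comp]

theorem singularMap_injective {Y : Type u} [TopologicalSpace Y] (f : C(X, Y))
    (hf : Function.Injective f) (n : ℕ) : Function.Injective ((singularMap f).f n).hom := by
  have : Mono (TopCat.ofHom f) := (TopCat.mono_iff_injective _).mpr hf
  have : Mono (singularMap f) := by
    unfold singularMap; infer_instance
  exact (ModuleCat.mono_iff_injective _).mp inferInstance

variable (X) in
/-- The augmented singular chain complex, shifted so that `n`-chains have degree `n + 1`. -/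
def augmentedChains : ChainComplex (ModuleCat.{u} (ZMod 2)) ℕ :=
  ChainComplex.augment (singularChains X) (augmentation X) d_augmentation

/-- The chains of `X` that come from the subspace `A`, as submodules of the augmented complex: in
degree `i + 1` the `i`-chains of `A`, in degree `0` all coefficients. -/
def chainsIn (A : Set X) : ∀ i, Submodule (ZMod 2) ((augmentedChains X).X i)
  | 0 => ⊤
  | i + 1 => LinearMap.range
      ((singularMap (⟨Subtype.val, continuous_subtype_val⟩ : C(A, X))).f i).hom

theorem chainsIn_mono {A B : Set X} (h : A ⊆ B) (i : ℕ) : chainsIn A i ≤ chainsIn B i := by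
  cases i with
  | zero => exact le_rfl
  | succ i =>
    rintro _ ⟨c, rfl⟩
    refine ⟨((singularMap (⟨Set.inclusion h, continuous_inclusion h⟩ : C(A, B))).f i).hom c, ?_⟩
    have := singularMap_comp (⟨Set.inclusion h, continuous_inclusion h⟩ : C(A, B))
      (⟨Subtype.val, continuous_subtype_val⟩ : C(B, X))
    rw [show ((⟨Subtype.val, continuous_subtype_val⟩ : C(A, X))) =
      (⟨Subtype.val, continuous_subtype_val⟩ : C(B, X)).comp
        ⟨Set.inclusion h, continuous_inclusion h⟩ from rfl, this]
    rfl

end Singular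

/-! ### Betti numbers and paths in terms of chains in a subspace -/

section Coloring

variable {X : Type u} [TopologicalSpace X]

/-- The augmentation of the homology in degree `0` is induced by the augmentation of chains. -/
theorem liftCycles_homologyπ_ε :
    (singularChains X).liftCycles (𝟙 _) 0 (by simp) (by simp) ≫
      (singularChains X).homologyπ 0 ≫ TopCat.singularHomology₀ε (TopCat.of X) coeffModule.{u} =
    augmentation X := by
  refine singularChains_hom_ext fun x => ?_
  rw [singularGenerator_augmentation]
  refine Eq.trans ?_ ((TopCat.toSSet.obj
    (TopCat.of X)).liftCycles_ιChainComplex_homologyπ_homology₀ε coeffModule.{u} x)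
  rw [← Category.assoc, HomologicalComplex.comp_liftCycles]
  simp only [Category.comp_id]
  rfl

theorem hasCycleColoring_top {b j : ℕ} (h : reducedBetti X j ≤ b) :
    HasCycleColoring (augmentedChains X) b j fun _ => ⊤ := by
  obtain ⟨π, hπ, hπ'⟩ := exists_homologyClass (singularChains X) j
  cases j with
  | zero =>
    obtain ⟨f, hf⟩ := exists_injective_of_rank_le h
    have hε : ∀ z, (TopCat.singularHomology₀ε (TopCat.of X) coeffModule.{u}).hom (π z) =
        (augmentation X).hom z := fun z => by
      have h1 := ConcreteCategory.congr_hom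
        ((singularChains X).liftCycles_i (𝟙 _) 0 (by simp) (by simp)) z
      have h2 := ConcreteCategory.congr_hom (liftCycles_homologyπ_ε (X := X)) z
      have h3 := hπ' (((singularChains X).liftCycles (𝟙 _) 0 (by simp) (by simp)).hom z)
      refine Eq.trans ?_ h2
      refine congrArg (TopCat.singularHomology₀ε (TopCat.of X) coeffModule.{u}).hom ?_
      refine Eq.trans ?_ h3
      exact congrArg π h1.symm
    classical
    refine ⟨fun z => if hz : (augmentation X).hom z = 0 then f ⟨π z, (hε z).trans hz⟩ else 0, ?_⟩
    intro z _ z' _ hz hz' hzz'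
    have hz : (augmentation X).hom z = 0 := hz
    have hz' : (augmentation X).hom z' = 0 := hz'
    simp only [dif_pos hz, dif_pos hz'] at hzz'
    obtain ⟨e, he⟩ := hπ z z' (by simp; rfl) (by simp; rfl) (congrArg Subtype.val (hf hzz'))
    exact ⟨e, trivial, he⟩
  | succ j =>
    obtain ⟨f, hf⟩ := exists_injective_of_rank_le h
    refine ⟨fun z => f (π z), fun z _ z' _ hz hz' hzz' => ?_⟩
    have hd : ∀ k, k = j → ∀ w, ((singularChains X).d (j + 1) j).hom w = 0 →
        ((singularChains X).d (j + 1) k).hom w = 0 := by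
      rintro _ rfl w hw
      exact hw
    obtain ⟨e, he⟩ := hπ z z' (hd _ (ChainComplex.next_nat_succ _) z hz)
      (hd _ (ChainComplex.next_nat_succ _) z' hz') (hf hzz')
    exact ⟨e, trivial, he⟩

/-- The bound on the Betti numbers of a subspace, in terms of chains of the ambient space. -/
theorem hasCycleColoring_chainsIn {A : Set X} {b j : ℕ} (h : reducedBetti A j ≤ b) :
    HasCycleColoring (augmentedChains X) b j (chainsIn A) := by
  obtain ⟨φ, hφ⟩ := hasCycleColoring_top h
  let inc : C(A, X) := ⟨Subtype.val, continuous_subtype_val⟩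
  have hinj : ∀ n, Function.Injective ((singularMap inc).f n).hom :=
    singularMap_injective inc Subtype.val_injective
  have hcyc : ∀ z : (singularChains A).X j,
      ((augmentedChains X).d (j + 1) j).hom (((singularMap inc).f j).hom z) = 0 →
      ((augmentedChains A).d (j + 1) j).hom z = 0 := fun z hz => by
    cases j with
    | zero => exact (ConcreteCategory.congr_hom (singularMap_augmentation inc) z).symm.trans hz
    | succ j =>
      refine hinj j (Eq.trans ?_ (hz.trans (map_zero _).symm))
      exact (ConcreteCategory.congr_hom ((singularMap inc).comm (j + 1) j) z).symm
  refine ⟨fun z => φ (Function.invFun ((singularMap inc).f j).hom z), ?_⟩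
  rintro _ ⟨z, rfl⟩ _ ⟨z', rfl⟩ hz hz' hzz'
  have hinv := Function.leftInverse_invFun (hinj j)
  have hzz' : φ z = φ z' :=
    (congrArg φ (hinv z)).symm.trans (hzz'.trans (congrArg φ (hinv z')))
  obtain ⟨e, -, he⟩ := hφ z trivial z' trivial (hcyc z hz) (hcyc z' hz') hzz'
  refine ⟨((singularMap inc).f (j + 1)).hom e, ⟨e, rfl⟩, ?_⟩
  refine Eq.trans (ConcreteCategory.congr_hom ((singularMap inc).comm (j + 1) j) e) ?_
  exact (congrArg ((singularMap inc).f j).hom he).trans (map_sub _ _ _)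

/-- A chain that comes from the subspace `A` is supported in `A`. -/
theorem chainSupport_subset {A : Set X} {n : ℕ} {c : (singularChains X).X n}
    (hc : c ∈ chainsIn A (n + 1)) : chainSupport c ⊆ A := by
  classical
  obtain ⟨c, rfl⟩ := hc
  refine Set.iUnion₂_subset fun x hx => ?_
  by_contra hA
  refine hx ?_
  have h0 : (singularMap (⟨Subtype.val, continuous_subtype_val⟩ : C(A, X))).f n ≫
      coeffHom x = 0 := by
    refine singularChains_hom_ext fun y => ?_
    rw [← Category.assoc, singularGenerator_map, singularGenerator_coeff, Limits.comp_zero,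
      if_neg]
    rintro rfl
    refine hA ?_
    rintro _ ⟨t, rfl⟩
    exact ((TopCat.toSSetObjEquiv (TopCat.of A) _ y) t).2
  exact ConcreteCategory.congr_hom h0 c

/-- The `0`-simplex at a point. -/
def pointSimplex (p : X) : SingularSimplex X 0 := TopCat.toSSetObj₀Equiv.symm p

/-- The `0`-chain consisting of one point. -/
def pointChain (p : X) : (singularChains X).X 0 :=
  (singularGenerator (pointSimplex p)).hom ⟨1⟩

theorem augmentation_pointChain (p : X) : (augmentation X).hom (pointChain p) = ⟨1⟩ :=
  ConcreteCategory.congr_hom (singularGenerator_augmentation (pointSimplex p)) ⟨1⟩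

theorem chainSimplices_pointChain (p : X) : chainSimplices (pointChain p) = {pointSimplex p} := by
  classical
  ext x
  have h := ConcreteCategory.congr_hom (singularGenerator_coeff x (pointSimplex p))
    (⟨1⟩ : ULift (ZMod 2))
  have h' : singularCoeff x (pointChain p) = ((if pointSimplex p = x then
    𝟙 coeffModule.{u} else 0 : coeffModule.{u} ⟶ coeffModule.{u}).hom ⟨1⟩) := h
  change singularCoeff x (pointChain p) ≠ 0 ↔ x = pointSimplex p
  rw [h']
  split_ifs with hx
  · have : (⟨1⟩ : ULift.{u} (ZMod 2)) ≠ 0 := fun h => one_ne_zero (congrArg ULift.down h)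
    simpa [hx] using this
  · simp [Ne.symm hx]

theorem singularMap_pointChain {Y : Type u} [TopologicalSpace Y] (f : C(X, Y)) (p : X) :
    ((singularMap f).f 0).hom (pointChain p) = pointChain (f p) := by
  have h := ConcreteCategory.congr_hom (singularGenerator_map f (pointSimplex p))
    (⟨1⟩ : ULift (ZMod 2))
  refine Eq.trans h ?_
  rfl

theorem pointChain_mem_chainsIn {A : Set X} {p : X} (hp : p ∈ A) :
    pointChain p ∈ chainsIn A 1 :=
  ⟨pointChain ⟨p, hp⟩, singularMap_pointChain _ _⟩

/-- The characteristic function of a path component is a cocycle. -/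
theorem exists_component_cocycle (p : X) :
    ∃ ψ : (singularChains X).X 0 ⟶ coeffModule.{u}, (singularChains X).d 1 0 ≫ ψ = 0 ∧
      ψ.hom (pointChain p) = ⟨1⟩ ∧ ∀ q, ¬ Joined p q → ψ.hom (pointChain q) = 0 := by
  classical
  let S := TopCat.toSSet.obj (TopCat.of X)
  let δ : (∐ fun _ : S.π₀ => coeffModule.{u}) ⟶ coeffModule.{u} := Limits.Sigma.desc fun a =>
    if a = SSet.π₀.mk (pointSimplex p) then 𝟙 coeffModule.{u} else 0
  have hδ : ∀ x : SingularSimplex X 0,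
      singularGenerator x ≫ SSet.π₀.fromChainComplexXZero S coeffModule.{u} ≫ δ =
      if SSet.π₀.mk x = SSet.π₀.mk (pointSimplex p) then 𝟙 coeffModule.{u} else 0 := fun x => by
    have := SSet.π₀.comp_fromChainComplexXZero S coeffModule.{u} x
    refine (Category.assoc _ _ _).symm.trans ?_
    refine Eq.trans (congrArg (· ≫ δ) this) ?_
    simp [δ]
  refine ⟨SSet.π₀.fromChainComplexXZero S coeffModule.{u} ≫ δ, ?_, ?_, fun q hq => ?_⟩
  · have := SSet.π₀.d_fromChainComplexXZero S coeffModule.{u} 1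
    refine (Category.assoc _ _ _).symm.trans ?_
    exact Eq.trans (congrArg (· ≫ δ) this) Limits.zero_comp
  · have h := hδ (pointSimplex p)
    rw [if_pos rfl] at h
    exact ConcreteCategory.congr_hom h (⟨1⟩ : ULift (ZMod 2))
  · have h := hδ (pointSimplex q)
    rw [if_neg] at h
    · exact ConcreteCategory.congr_hom h (⟨1⟩ : ULift (ZMod 2))
    · intro hmk
      refine hq ?_
      have h := TopCat.zerothHomotopyEquiv.injective
        ((TopCat.zerothHomotopyEquiv_mk (X := TopCat.of X) q).trans (hmk.trans
          (TopCat.zerothHomotopyEquiv_mk (X := TopCat.of X) p).symm))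
      have h' : q ∈ (ZerothHomotopy.mk ⁻¹' {ZerothHomotopy.mk p} : Set X) := h
      rw [ZerothHomotopy.preimage_singleton_eq_pathComponent] at h'
      exact h'

/-- Two points whose sum bounds a chain in `A` can be joined by a path in `A`. -/
theorem joinedIn_of_boundary {A : Set X} {p q : X} (hp : p ∈ A) (hq : q ∈ A)
    {c : (singularChains X).X 1} (hc : c ∈ chainsIn A 2)
    (h : ((singularChains X).d 1 0).hom c = pointChain p + pointChain q) : JoinedIn A p q := by
  let inc : C(A, X) := ⟨Subtype.val, continuous_subtype_val⟩
  obtain ⟨c, rfl⟩ := hc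
  have hd : ((singularChains A).d 1 0).hom c = pointChain ⟨p, hp⟩ + pointChain ⟨q, hq⟩ := by
    refine singularMap_injective inc Subtype.val_injective 0 ?_
    refine (ConcreteCategory.congr_hom ((singularMap inc).comm 1 0) c).symm.trans (h.trans ?_)
    rw [map_add, singularMap_pointChain, singularMap_pointChain]
    rfl
  obtain ⟨ψ, hψd, hψp, hψq⟩ := exists_component_cocycle (⟨p, hp⟩ : A)
  refine (joinedIn_iff_joined hp hq).mpr ?_
  by_contra hne
  have hsum : ψ.hom (pointChain ⟨p, hp⟩) + ψ.hom (pointChain ⟨q, hq⟩) = 0 := by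
    rw [← map_add, ← hd]
    exact ConcreteCategory.congr_hom hψd c
  rw [hψp, hψq _ hne, add_zero] at hsum
  exact one_ne_zero (congrArg ULift.down hsum)

end Coloring

/-! ### Chain maps from sets without Radon partition -/

section Radon

variable {R : Type u}

theorem relConv_mono (F : Set (Set R)) {S T : Set R} (h : S ⊆ T) :
    relConv F S ⊆ relConv F T :=
  Set.sInter_subset_sInter fun _ hA => ⟨hA.1, h.trans hA.2⟩

theorem subset_relConv (F : Set (Set R)) (S : Set R) : S ⊆ relConv F S :=
  Set.subset_sInter fun _ hA => hA.2

theorem reducedBetti_relConv_le [TopologicalSpace R] {F : Set (Set R)} {k : ℕ∞} {b : ℕ∞}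
    (h : topComplexity k F ≤ b) {i : ℕ} (hi : (i : ℕ∞) < k) (S : Set R) :
    reducedBetti (relConv F S) i ≤ b := by
  refine le_trans ?_ h
  exact le_iSup₂_of_le {A | A ∈ F ∧ S ⊆ A} (fun _ hA => hA.1)
    (le_iSup₂_of_le (f := fun (i : ℕ) (_ : (i : ℕ∞) < k) =>
      reducedBetti (⋂₀ {A | A ∈ F ∧ S ⊆ A} : Set R) i) i hi le_rfl)

/-- Enlarging one of two disjoint nonempty sets gives a partition of all of `S`. -/
theorem disjoint_relConv_of_no_radon_partition {F : Set (Set R)} {S : Finset R}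
    (hS : ¬ ∃ P₁ P₂ : Set R, P₁.Nonempty ∧ P₂.Nonempty ∧ Disjoint P₁ P₂ ∧ P₁ ∪ P₂ = (S : Set R) ∧
      (relConv F P₁ ∩ relConv F P₂).Nonempty)
    {A B : Set R} (hA : A ⊆ S) (hB : B ⊆ S) (hA' : A.Nonempty) (hB' : B.Nonempty)
    (hAB : Disjoint A B) : Disjoint (relConv F A) (relConv F B) := by
  rw [Set.disjoint_iff_inter_eq_empty, ← Set.not_nonempty_iff_eq_empty]
  intro hne
  have hsub : B ⊆ (S : Set R) \ A := Set.subset_sdiff.mpr ⟨hB, hAB.symm⟩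
  refine hS ⟨A, (S : Set R) \ A, hA', hB'.mono hsub, Set.disjoint_sdiff_right,
    Set.union_sdiff_cancel hA, hne.mono ?_⟩
  exact Set.inter_subset_inter_right _ (relConv_mono F hsub)

/-- The augmented chain map on the `0`-skeleton given by a sequence of points. Only the values on
the empty set in degree `0` and on singletons in degree `1` matter. -/
def vertexChain [TopologicalSpace R] {N : ℕ} (x : Fin N → R) :
    ∀ i, Finset (Fin N) → (augmentedChains R).X i
  | 0, _ => (⟨1⟩ : ULift (ZMod 2))
  | 1, s => (∑ v ∈ s, pointChain (x v) : (singularChains R).X 0)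
  | _ + 2, _ => 0

theorem isCarriedChainMap_vertexChain [TopologicalSpace R] {N : ℕ} (x : Fin N → R)
    {C : Finset (Fin N) → Set R} (hC : ∀ v, x v ∈ C {v}) :
    IsCarriedChainMap (augmentedChains R) (fun A => chainsIn (C A)) 1 (vertexChain x) where
  d_eq i s hs hi := by
    obtain rfl : i = 0 := by omega
    obtain ⟨v, rfl⟩ := Finset.card_eq_one.mp hs
    rw [Finset.sum_singleton]
    have : vertexChain x (0 + 1) {v} = pointChain (x v) := Finset.sum_singleton _ _
    rw [this]
    exact augmentation_pointChain (x v)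
  mem i s hs hi := by
    interval_cases i
    · trivial
    · obtain ⟨v, rfl⟩ := Finset.card_eq_one.mp hs
      have : vertexChain x 1 {v} = pointChain (x v) := Finset.sum_singleton _ _
      rw [this]
      exact pointChain_mem_chainsIn (hC v)

/-- If `r` points have no Radon partition, then there is a chain map on a skeleton of a simplex
whose carriers are disjoint on disjoint faces. -/
theorem exists_disjointly_carried_chainMap (b n N' : ℕ) :
    ∃ r : ℕ, ∀ (R : Type u) [TopologicalSpace R] (F : Set (Set R)),
      topComplexity n F ≤ b → ¬ HasRadonProperty F r →
      ∃ (C : Finset (Fin N') → Set R) (g : ∀ i, Finset (Fin N') → (augmentedChains R).X i)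
        (x : Fin N' → R),
        IsCarriedChainMap (augmentedChains R) (fun A => chainsIn (C A)) (n + 1) g ∧
        (∀ A B, A.Nonempty → B.Nonempty → Disjoint A B → Disjoint (C A) (C B)) ∧
        Monotone C ∧ ∀ v, x v ∈ C {v} ∧ g 1 {v} = pointChain (x v) := by
  obtain ⟨N, hN⟩ := exists_carried_chainMap.{u} b n N'
  refine ⟨N, fun R _ F hF hR => ?_⟩
  unfold HasRadonProperty at hR
  push Not at hR
  obtain ⟨S, hS, hR⟩ := hR
  let e : Fin N ≃ S := (S.equivFinOfCardEq hS).symm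
  let y : Fin N → R := fun i => e i
  have hy : Function.Injective y := Subtype.val_injective.comp e.injective
  have hyS : ∀ A : Set (Fin N), y '' A ⊆ S := by
    rintro A _ ⟨i, -, rfl⟩
    exact (e i).2
  let C : Finset (Fin N) → Set R := fun A => relConv F (y '' A)
  have hC : Monotone C := fun A B h => relConv_mono F (Set.image_mono (Finset.coe_subset.mpr h))
  obtain ⟨Ψ, g, p, hg, hΨ, hΨd, hp⟩ := hN (augmentedChains R) (fun A => chainsIn (C A))
    (vertexChain y) (fun A B h => chainsIn_mono (hC h))
    (fun A j hj => hasCycleColoring_chainsIn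
      (reducedBetti_relConv_le hF (by exact_mod_cast hj) _))
    (isCarriedChainMap_vertexChain y fun v => subset_relConv F _ ⟨v, by simp, rfl⟩)
  have hΨne : ∀ A, A.Nonempty → (Ψ A).Nonempty := by
    rintro A ⟨v, hv⟩
    exact ⟨p v, hΨ (Finset.singleton_subset_iff.mpr hv) (hp v).1⟩
  refine ⟨fun A => C (Ψ A), g, fun v => y (p v), hg, fun A B hA hB hAB => ?_,
    fun A B h => hC (hΨ h), fun v => ⟨?_, ?_⟩⟩
  · refine disjoint_relConv_of_no_radon_partition (S := S) ?_ (hyS _) (hyS _)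
      ((hΨne A hA).to_set.image y) ((hΨne B hB).to_set.image y) ?_
    · rintro ⟨P₁, P₂, h₁, h₂, h₃, h₄, h₅⟩
      exact h₅.ne_empty (hR P₁ P₂ h₁ h₂ h₃ h₄)
    · rw [Set.disjoint_image_iff hy]
      exact_mod_cast hΨd A B hAB
  · exact subset_relConv F _ ⟨p v, (hp v).1, rfl⟩
  · rw [(hp v).2]
    exact Finset.sum_singleton _ _

end Radon

/-! ### Almost-embeddings of a complex -/

section Complex

variable {V : Type v} (K : AbstractSimplicialComplex V) {R : Type u} [TopologicalSpace R]

theorem exists_dimension_eq [Fintype V] :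
    ∃ n : ℕ, K.dimension = n ∧ ∀ s ∈ K.faces, s.card ≤ n + 1 := by
  have hle : K.dimension ≤ (Fintype.card V : ℕ) := iSup₂_le fun s _ => by
    exact_mod_cast (Nat.sub_le _ _).trans (Finset.card_le_univ s)
  obtain ⟨n, hn⟩ := ENat.ne_top_iff_exists.mp (ne_top_of_le_ne_top (ENat.natCast_ne_top _) hle)
  refine ⟨n, hn.symm, fun s hs => ?_⟩
  have h : ((s.card - 1 : ℕ) : ℕ∞) ≤ n :=
    hn ▸ le_iSup₂ (f := fun (s : Finset V) (_ : s ∈ K.faces) => ((s.card - 1 : ℕ) : ℕ∞)) s hs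
  have : s.card - 1 ≤ n := by exact_mod_cast h
  omega

/-- A carried chain map on the skeleton of a full simplex restricts to a subcomplex. -/
theorem exists_isHomologicalAlmostEmbedding {n N : ℕ} (e : V ≃ Fin N)
    (hn : ∀ s ∈ K.faces, s.card ≤ n + 1) {C : Finset (Fin N) → Set R}
    {g : ∀ i, Finset (Fin N) → (augmentedChains R).X i} {x : Fin N → R}
    (hg : IsCarriedChainMap (augmentedChains R) (fun A => chainsIn (C A)) (n + 1) g)
    (hC : ∀ A B, A.Nonempty → B.Nonempty → Disjoint A B → Disjoint (C A) (C B))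
    (hx : ∀ v, g 1 {v} = pointChain (x v)) :
    ∃ γ : K.SingularChainMap R, γ.IsHomologicalAlmostEmbedding := by
  classical
  let c : ∀ i, K.Simplex i → (singularChains R).X i := fun i s =>
    g (i + 1) (s.1.map e.toEmbedding)
  have hd : ∀ i (s : K.Simplex (i + 1)), ((singularChains R).d (i + 1) i).hom (c (i + 1) s) =
      ∑ w ∈ s.1.attach, c i (K.facet s w) := fun i s => by
    refine (hg.d_eq (i + 1) (s.1.map e.toEmbedding) (by rw [Finset.card_map, s.2.2])
      (by have := hn _ s.2.1; rw [s.2.2] at this; omega)).trans ?_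
    rw [Finset.sum_map, ← Finset.sum_attach]
    refine Finset.sum_congr rfl fun w _ => ?_
    change _ = g (i + 1) ((K.facet s w).1.map e.toEmbedding)
    congr 1
    simp only [AbstractSimplicialComplex.facet]
    rw [← Finset.map_erase]
  let γ : K.SingularChainMap R :=
    { app i := Finsupp.linearCombination (ZMod 2) (c i)
      comm i := by
        refine Finsupp.lhom_ext' fun s => LinearMap.ext_ring ?_
        simp only [LinearMap.comp_apply, Finsupp.lsingle_apply]
        rw [AbstractSimplicialComplex.boundary, Finsupp.linearCombination_single,
          Finsupp.linearCombination_single, one_smul, one_smul, map_sum, hd]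
        exact Finset.sum_congr rfl fun w _ => by
          rw [Finsupp.linearCombination_single, one_smul] }
  have hγ : ∀ {i} (s : K.Simplex i), γ.onSimplex s = c i s := fun {i} s =>
    (Finsupp.linearCombination_single _ _ _).trans (one_smul _ _)
  have hsupp : ∀ {i} (s : K.Simplex i),
      chainSupport (γ.onSimplex s) ⊆ C (s.1.map e.toEmbedding) := fun {i} s => by
    refine chainSupport_subset ?_
    rw [hγ]
    exact hg.mem (i + 1) _ (by rw [Finset.card_map, s.2.2])
      (by have := hn _ s.2.1; rwa [s.2.2] at this)
  refine ⟨γ, fun s => ?_, fun i j s t hst => ?_⟩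
  · obtain ⟨v, hv⟩ := Finset.card_eq_one.mp s.2.2
    have : γ.onSimplex s = pointChain (x (e v)) := by
      rw [hγ]
      change g 1 (s.1.map e.toEmbedding) = pointChain (x (e v))
      rw [hv, Finset.map_singleton]
      exact hx (e v)
    rw [this, chainSimplices_pointChain, Set.ncard_singleton]
    exact odd_one
  · exact (hC _ _ (Finset.map_nonempty.mpr (K.isRelLowerSet_faces s.2.1).1)
      (Finset.map_nonempty.mpr (K.isRelLowerSet_faces t.2.1).1)
      ((Finset.disjoint_map _).mpr hst)).mono (hsupp s) (hsupp t)

end Complex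

section Graph

variable {V : Type v} [Fintype V] (K : AbstractSimplicialComplex V) {R : Type u}
  [TopologicalSpace R]

theorem isClosed_closedSimplex (s : Finset V) : IsClosed (K.closedSimplex s) := by
  have : K.closedSimplex s = ⋂ w ∉ s, {p : K.realization | p.1 w = 0} := by
    ext p
    simp only [AbstractSimplicialComplex.closedSimplex, Set.mem_ofPred_eq, Set.mem_iInter]
    exact forall_congr' fun w => not_imp_comm
  rw [this]
  exact isClosed_biInter fun w _ => isClosed_eq
    ((continuous_apply w).comp continuous_subtype_val) continuous_const

/-- A point that lies on two different faces of a graph is a vertex of both. -/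
theorem exists_vertex_of_mem_closedSimplex_inter {s t : Finset V} (hs : s.card ≤ 2)
    (ht : t.card ≤ 2) (hst : s ≠ t) {p : K.realization} (hps : p ∈ K.closedSimplex s)
    (hpt : p ∈ K.closedSimplex t) : ∃ w ∈ s, w ∈ t ∧ p.1 w = 1 := by
  classical
  have hsum : ∑ w, p.1 w = 1 := p.2.1.2
  have hsupp : ∀ w, p.1 w ≠ 0 → w ∈ s ∩ t := fun w hw =>
    Finset.mem_inter.mpr ⟨hps w hw, hpt w hw⟩
  have hcard : (s ∩ t).card ≤ 1 := by
    by_contra! h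
    have h1 : s ∩ t = s := Finset.eq_of_subset_of_card_le Finset.inter_subset_left (by omega)
    have h2 : s ∩ t = t := Finset.eq_of_subset_of_card_le Finset.inter_subset_right (by omega)
    exact hst (h1.symm.trans h2)
  obtain ⟨w, -, hw⟩ := Finset.exists_ne_zero_of_sum_ne_zero (hsum.trans_ne one_ne_zero)
  have hwst := hsupp w hw
  refine ⟨w, (Finset.mem_inter.mp hwst).1, (Finset.mem_inter.mp hwst).2, ?_⟩
  rw [← hsum]
  refine (Finset.sum_eq_single w (fun v _ hv => ?_) (fun h => absurd (Finset.mem_univ w) h)).symm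
  by_contra h
  exact hv (Finset.card_le_one.mp hcard v (hsupp v h) w hwst)

/-- A graph is almost-embedded by choosing a path in the carrier of every edge. -/
theorem exists_isAlmostEmbedding_of_joinedIn (hK : ∀ s ∈ K.faces, s.card ≤ 2)
    (x : V → R) (C : Finset V → Set R)
    (hC : ∀ s ∈ K.faces, ∀ t ∈ K.faces, Disjoint s t → Disjoint (C s) (C t))
    (hx : ∀ s ∈ K.faces, ∀ u ∈ s, ∀ v ∈ s, JoinedIn (C s) (x u) (x v)) :
    ∃ f : C(K.realization, R), K.IsAlmostEmbedding f := by
  classical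
  have hedge : ∀ s : K.faces, ∃ u v, s.1 = {u, v} := fun ⟨s, hs⟩ => by
    have h2 := hK s hs
    have h1 := Finset.card_pos.mpr (K.isRelLowerSet_faces hs).1
    interval_cases h : s.card
    · obtain ⟨u, rfl⟩ := Finset.card_eq_one.mp h
      exact ⟨u, u, by simp⟩
    · obtain ⟨u, v, -, rfl⟩ := Finset.card_eq_two.mp h
      exact ⟨u, v, rfl⟩
  choose a c hac using hedge
  have hj : ∀ s : K.faces, JoinedIn (C s.1) (x (a s)) (x (c s)) := fun s =>
    hx s.1 s.2 _ (by rw [hac s]; simp) _ (by rw [hac s]; simp)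
  -- The map on a single edge. For a face that is a vertex, `a s = c s`, and only the value at the
  -- end of the chosen loop is used.
  let f₀ : K.faces → K.realization → R := fun s p => (hj s).somePath.extend (p.1 (c s))
  have hf₀ : ∀ s, Continuous (f₀ s) := fun s => (hj s).somePath.continuous_extend.comp
    ((continuous_apply _).comp continuous_subtype_val)
  have hf₀C : ∀ s p, f₀ s p ∈ C s.1 := fun s p => by
    have h01 : p.1 (c s) ∈ unitInterval :=
      ⟨p.2.1.1 _, p.2.1.2 ▸ Finset.single_le_sum (fun w _ => p.2.1.1 w) (Finset.mem_univ _)⟩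
    simp only [f₀]
    rw [Path.extend_apply _ h01]
    exact (hj s).somePath_mem _
  have hf₀v : ∀ (s : K.faces) (p : K.realization) (w : V), w ∈ s.1 → p.1 w = 1 →
      f₀ s p = x w := fun s p w hw hpw => by
    have hzero : ∀ v, v ≠ w → p.1 v = 0 := fun v hv => by
      have h1 : ∑ v ∈ Finset.univ.erase w, p.1 v = 0 := by
        have := Finset.add_sum_erase Finset.univ p.1 (Finset.mem_univ w)
        have h2 : ∑ v, p.1 v = 1 := p.2.1.2
        linarith
      exact (Finset.sum_eq_zero_iff_of_nonneg fun v _ => p.2.1.1 v).mp h1 v (by simp [hv])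
    simp only [f₀]
    by_cases hwc : w = c s
    · have hpc : p.1 (c s) = 1 := hwc ▸ hpw
      rw [hpc, Path.extend_one, hwc]
    · have hwa : w = a s := by
        rw [hac s] at hw
        simpa [hwc] using hw
      rw [hzero _ (Ne.symm hwc), Path.extend_zero, hwa]
  have hface : ∀ p : K.realization, ∃ s : K.faces, p ∈ K.closedSimplex s.1 := fun p => by
    obtain ⟨s, hs, hp⟩ := p.2.2
    exact ⟨⟨s, hs⟩, hp⟩
  choose σ hσ using hface
  have hf : ∀ (s : K.faces) (p), p ∈ K.closedSimplex s.1 → f₀ (σ p) p = f₀ s p := fun s p hp => by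
    by_cases hs : σ p = s
    · rw [hs]
    · obtain ⟨w, hw, hw', hpw⟩ := exists_vertex_of_mem_closedSimplex_inter K (hK _ (σ p).2)
        (hK _ s.2) (fun h => hs (Subtype.ext h)) (hσ p) hp
      rw [hf₀v _ p w hw hpw, hf₀v _ p w hw' hpw]
  have hcont : Continuous fun p => f₀ (σ p) p := by
    refine (locallyFinite_of_finite fun s : K.faces => K.closedSimplex s.1).continuous ?_
      (fun s => isClosed_closedSimplex K s.1) fun s => ?_
    · exact Set.eq_univ_of_forall fun p => Set.mem_iUnion.mpr ⟨σ p, hσ p⟩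
    · exact (hf₀ s).continuousOn.congr fun p hp => hf s p hp
  have himage : ∀ s (hs : s ∈ K.faces), (fun p => f₀ (σ p) p) '' K.closedSimplex s ⊆ C s := by
    rintro s hs _ ⟨p, hp, rfl⟩
    simp only [hf ⟨s, hs⟩ p hp]
    exact hf₀C ⟨s, hs⟩ p
  exact ⟨⟨_, hcont⟩, fun s hs t ht hst => (hC s hs t ht hst).mono (himage s hs) (himage t ht)⟩

/-- A carried chain map yields an almost-embedding of a graph: the image of an edge under the chain
map witnesses that the images of its ends are joined in the carrier of the edge. -/
theorem exists_isAlmostEmbedding {n N : ℕ} (e : V ≃ Fin N)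
    (hn : ∀ s ∈ K.faces, s.card ≤ n + 1) (hn' : n ≤ 1) {C : Finset (Fin N) → Set R}
    {g : ∀ i, Finset (Fin N) → (augmentedChains R).X i} {x : Fin N → R}
    (hg : IsCarriedChainMap (augmentedChains R) (fun A => chainsIn (C A)) (n + 1) g)
    (hC : ∀ A B, A.Nonempty → B.Nonempty → Disjoint A B → Disjoint (C A) (C B))
    (hCm : Monotone C) (hx : ∀ v, x v ∈ C {v} ∧ g 1 {v} = pointChain (x v)) :
    ∃ f : C(K.realization, R), K.IsAlmostEmbedding f := by
  classical
  refine exists_isAlmostEmbedding_of_joinedIn K (fun s hs => (hn s hs).trans (by omega))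
    (fun v => x (e v)) (fun s => C (s.map e.toEmbedding)) (fun s hs t ht hst => ?_)
    fun s hs a ha c hc => ?_
  · exact hC _ _ (Finset.map_nonempty.mpr (K.isRelLowerSet_faces hs).1)
      (Finset.map_nonempty.mpr (K.isRelLowerSet_faces ht).1) ((Finset.disjoint_map _).mpr hst)
  · have hmem : ∀ v ∈ s, x (e v) ∈ C (s.map e.toEmbedding) := fun v hv =>
      hCm (Finset.singleton_subset_iff.mpr (Finset.mem_map_of_mem _ hv)) (hx (e v)).1
    by_cases hac : a = c
    · subst hac
      exact JoinedIn.refl (hmem a ha)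
    have hpair : ({a, c} : Finset V) = s := by
      refine Finset.eq_of_subset_of_card_le (fun v hv => ?_) ?_
      · rcases Finset.mem_insert.mp hv with rfl | hv
        · exact ha
        · exact Finset.mem_singleton.mp hv ▸ hc
      · rw [Finset.card_pair hac]
        exact (hn s hs).trans (by omega)
    have hne : e a ≠ e c := e.injective.ne hac
    have hmap : s.map e.toEmbedding = {e a, e c} := by
      rw [← hpair]
      simp [Finset.map_insert]
    have hcard : (s.map e.toEmbedding).card = 2 := by rw [hmap, Finset.card_pair hne]
    have hn1 : 2 ≤ n + 1 := by
      rw [← hcard, Finset.card_map]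
      exact hn s hs
    refine joinedIn_of_boundary (hmem a ha) (hmem c hc) (c := g 2 (s.map e.toEmbedding))
      (hg.mem 2 _ hcard hn1) ?_
    refine (hg.d_eq 1 _ hcard hn1).trans ?_
    rw [hmap, Finset.sum_pair hne, Finset.erase_insert (by simpa using hne),
      Finset.erase_insert_of_ne hne, Finset.erase_singleton, insert_empty_eq, (hx _).2, (hx _).2]
    exact add_comm (pointChain (x (e c))) (pointChain (x (e a)))

end Graph

end

theorem proposition11 {V : Type v} [Fintype V] (K : AbstractSimplicialComplex V) (b : ℕ) :
    ∃ rKb : ℕ, ∀ (R : Type u) [TopologicalSpace R],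
      ((¬ ∃ γ : K.SingularChainMap R, γ.IsHomologicalAlmostEmbedding) →
        ∀ F : Set (Set R), F.Finite → topComplexity K.dimension F ≤ (b : ℕ∞) →
          radonNumber F ≤ (rKb : ℕ∞)) ∧
      (K.dimension ≤ 1 → (¬ ∃ f : C(K.realization, R), K.IsAlmostEmbedding f) →
        ∀ F : Set (Set R), F.Finite → topComplexity K.dimension F ≤ (b : ℕ∞) →
          radonNumber F ≤ (rKb : ℕ∞)) := by
  obtain ⟨n, hn, hface⟩ := exists_dimension_eq K
  obtain ⟨r, hr⟩ := exists_disjointly_carried_chainMap.{u} b n (Fintype.card V)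
  have e := Fintype.equivFin V
  refine ⟨r, fun R _ => ⟨fun hK F _ hF => ?_, fun hdim hK F _ hF => ?_⟩⟩
  · refine iInf₂_le r ?_
    by_contra hrad
    obtain ⟨C, g, x, hg, hC, -, hx⟩ := hr R F (hn ▸ hF) hrad
    exact hK (exists_isHomologicalAlmostEmbedding K e hface hg hC fun v => (hx v).2)
  · refine iInf₂_le r ?_
    by_contra hrad
    obtain ⟨C, g, x, hg, hC, hCm, hx⟩ := hr R F (hn ▸ hF) hrad
    rw [hn] at hdim
    exact hK (exists_isAlmostEmbedding K e hface (by exact_mod_cast hdim) hg hC hCm hx)
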